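/- **Documents and DTDs.** A DTD $D=(Ele,P,root)$ has a finite set $Ele$ of element types and assigns to each $A\in Ele$ a content model $P(A)$, built by $\alpha ::= str \mid \epsilon \mid B \mid \alpha,\alpha \mid \alpha|\alpha \mid \alpha^*$ with $B\in Ele$; $D$ may be recursive. An instance $T$ of $D$ is a finite ordered tree whose nodes are labelled by element types or are text nodes carrying a string, such that the root is the only node labelled $root$, the children of each $A$-node spell a word of the regular language of $P(A)$, and text nodes are leaves. **Queries.** The fragment $\mathcal X$ is given by $path ::= axis::l \mid path[qual] \mid path/path \mid path\cup path$ and $qual ::= path \mid path=c \mid qual\ and\ qual \mid qual\ or\ qual \mid not\ qual$, with $axis\in\{\downarrow,\downarrow^+\}$ (child, descendant), $l\in Ele\cup\{*\}$ and $c$ a string. The fragment $\mathcal X^{\Uparrow}_{[n,=]}$ also has the axes $\varepsilon,\uparrow,\uparrow^+,\uparrow^*$ (self, parent, ancestor, ancestor-or-self), the position predicate $path[k]$ ($k$-th selected node; upward steps are counted from the context node towards the root, everything else in document order) and the comparison $path=\varepsilon::l$. The label $*$ matches every element node and no text node. Comparisons are existential: $path=c$ holds at $n$ if some selected node has text content $c$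 (the concatenation of its text children), and $path=\varepsilon::l$ holds at $n$ if some node is selected by both sides. $Q(T)$ is the set of nodes that $Q$ selects from the root of $T$. **Views.** An access specification consists of $D$ and a partial map $ann$, defined on some pairs $(A,B)$ with $B$ occurring in $P(A)$, with values $Y$, $N$ or $[Q]$, $Q$ a qualifier of $\mathcal X$. A $B$-node with an $A$-parent is concerned by $ann(A,B)$ if this is defined; the root is concerned by $Y$. The annotation is valid at $n$ if it is $Y$, or if it is $[Q]$ and $Q$ holds at $n$. An element node $n$ of $T$ is accessible if (i) it is concerned by a valid annotation, or it is concerned by none and its nearest annotated ancestor is concerned by a valid one; and (ii) $Q'$ holds at every proper ancestor of $n$ concerned by an annotation $[Q']$. A text node is accessible iff its parent is. The view $T_v$ consists of the accessible nodes with the ancestor relation and document order of $T$, so the parent of a node in $T_v$ is its nearest accessible ancestor. In the DTD view $D_v$, $B$ is a child type of $A$ if $B$ occurs in the content model obtained from $P(A)$ by keeping the visible types (annotated $Y$ or $[Q]$, or unannotated below a visible type) and replacing, repeatedly, each hidden type (annotated $N$, or unannotated below a hidden type) by its own content model; $|D_v|$ is the number of types that can be reached from $root$ in this way, $root$ included.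 The pair $V=(D_v,ann)$ is the security view. **Predicates.** Put $\mathcal A_1^{acc} := \uparrow^*::*\,[\varepsilon::root \vee \bigvee_{ann(A',A)\ \text{defined}}\varepsilon::A/\uparrow::A'][1]\,[\varepsilon::root\vee\bigvee_{ann(A',A)=Y}\varepsilon::A/\uparrow::A'\vee\bigvee_{ann(A',A)=[Q]}\varepsilon::A[Q]/\uparrow::A']$, $\mathcal A_2^{acc} := \bigwedge_{ann(A',A)=[Q]} not(\uparrow^+::A[not\,Q]/\uparrow::A')$, $\mathcal A^{acc}:=\mathcal A_1^{acc}\wedge\mathcal A_2^{acc}$, $\mathcal A^+:=\uparrow^+::*[\mathcal A_1^{acc}]$ and $\mathcal A^B:=\mathcal A^+[1]/\varepsilon::B$. **The algorithm.** $\mathtt{Rewrite}$ processes the steps of $Q$ from left to right, starting from $L=\{root\}$ and keeping the set $L$ of types of $D_v$ that the part processed so far may reach, where $*$ is replaced by the child or descendant types in $D_v$ of the types in $L$. With $fs(L,axis)=\bigcup_{E\in L}axis::E$, the way back along a step taken from types $L$ is $\mathcal A^+[1]/fs(L,\varepsilon)$ for $\downarrow$ and $fs(L,\uparrow^+)[\mathcal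 A^{acc}]$ for $\downarrow^+$; ways back are composed in reverse order, with the rewritten filters inserted, and the way back through a union inside a path is the union of the ways back through its members. The result is $fs(L,\downarrow^+)[\mathcal A^{acc}][filters][way\ back]$ for the final $L$; a union at the top is rewritten member by member. A path predicate $q_f/q_r$ from types $L$ is rewritten as $fs(L_f,\downarrow^+)[\mathcal A^{acc}][filters][q_r']/(way\ back)=\varepsilon::*$, where $L_f$ is the set of types reached by $q_f$ and $q_r'$ is the rewriting of $q_r$ from $L_f$ (without the comparison if $q_f$ is a single, possibly filtered, $\downarrow^+$ step); a predicate $p=c$ gets the filter $[\varepsilon::*=c]$ on its last step; Boolean operators are rewritten componentwise, with constants true and false propagated. If no type is reached, a predicate is false and a query becomes the empty query $\varepsilon::*[not(\varepsilon::*)]$. **Theorem.** There is an absolute constant $C$ such that the following holds for every access specification over every DTD $D$, recursive or not, with security view $V=(D_v,ann)$. 1. For every query $Q$ of $\mathcal X$ with labels in $Ele\cup\{*\}$ (in particular every query over $D_v$), $\mathtt{Rewrite}$ produces a query $Q_t$ of $\mathcal X^{\Uparrow}_{[n,=]}$ such that $Q(T_v)=Q_t(T)$ for every instance $T$ of $D$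 and its view $T_v$, in at most $C\cdot|Q|\cdot|D_v|^2$ steps. Here $|Q|$ is the number of axis steps and negations in $Q$. One step is charged for each visit of a node of the syntax tree of $Q$, each constructor of an expression that is written, each table look-up and each turn of a loop over types; the element types and the table of child and descendant types of $D_v$, as well as $\mathcal A^{acc}$ and $\mathcal A^+$, are computed once for $V$ beforehand and are used as single symbols. 2. For every instance $T$ of $D$, an element node $n$ of $T$ is accessible if and only if $\mathcal A^{acc}$ holds at $n$; and for every accessible element node $n$ and every element type $B$, the predicate $\mathcal A^B$ holds at $n$ if and only if $n$ has a parent of type $B$ in $T_v$. -/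

import Mathlib

namespace SecureXML

/-! ### DTDs -/

/-- Content models `α ::= str | ε | B | α,α | α"|"α | α*`. -/
inductive ContentModel (Ele : Type) : Type
  | str : ContentModel Ele
  | eps : ContentModel Ele
  | elem : Ele → ContentModel Ele
  | concat : ContentModel Ele → ContentModel Ele → ContentModel Ele
  | alt : ContentModel Ele → ContentModel Ele → ContentModel Ele
  | star : ContentModel Ele → ContentModel Ele

/-- The regular language of a content model; the letter `none` is the text type, the letter
`some B` the element type `B`. -/
def ContentModel.lang {Ele : Type} : ContentModel Ele → Language (Option Ele)
  | .str => {[none]}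
  | .eps => 1
  | .elem B => {[some B]}
  | .concat a b => a.lang * b.lang
  | .alt a b => a.lang + b.lang
  | .star a => KStar.kstar a.lang

/-- The element type `B` occurs in a content model. -/
def ContentModel.Occurs {Ele : Type} (B : Ele) : ContentModel Ele → Prop
  | .str => False
  | .eps => False
  | .elem A => A = B
  | .concat a b => a.Occurs B ∨ b.Occurs B
  | .alt a b => a.Occurs B ∨ b.Occurs B
  | .star a => a.Occurs B

/-- A DTD over the element types `Ele`; it may be recursive. -/
structure DTD (Ele : Type) where
  prod : Ele → ContentModel Ele
  root : Ele

/-! ### XML trees -/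

/-- A node carries an element type, or it is a text node with a string value. -/
inductive NodeLabel (Ele : Type) : Type
  | elem : Ele → NodeLabel Ele
  | text : String → NodeLabel Ele

/-- The letter that a node contributes to the children word of its parent. -/
def NodeLabel.letter {Ele : Type} : NodeLabel Ele → Option Ele
  | .elem A => some A
  | .text _ => none

/-- The string value of a text node. -/
def NodeLabel.textValue {Ele : Type} : NodeLabel Ele → Option String
  | .elem _ => none
  | .text s => some s

/-- Finite unranked ordered labelled trees, given by the proper-ancestor relation `anc` and the
document order `≤` (preorder). The last three laws say that ancestors precede their
descendants, that the nodes of a subtree are consecutive in document order, and that there is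
one root. The parent-child relation and the order of siblings are read off from these two. -/
structure XMLTree (Ele : Type) where
  Node : Type
  [fintype : Fintype Node]
  [order : LinearOrder Node]
  root : Node
  label : Node → NodeLabel Ele
  anc : Node → Node → Prop
  anc_trans : ∀ {a b c : Node}, anc a b → anc b c → anc a c
  lt_of_anc : ∀ {a b : Node}, anc a b → a < b
  anc_of_lt_of_lt : ∀ {a b c : Node}, anc a c → a < b → b < c → anc a b
  root_anc : ∀ n : Node, n ≠ root → anc root n

attribute [instance] XMLTree.fintype XMLTree.order

namespace XMLTree

variable {Ele : Type}

/-- `T.child m n`: the node `m` is the parent of the node `n`. -/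
def child (T : XMLTree Ele) (m n : T.Node) : Prop :=
  T.anc m n ∧ ¬ ∃ k, T.anc m k ∧ T.anc k n

open Classical in
/-- The set `{m | P m}` listed in document order. -/
noncomputable def listing (T : XMLTree Ele) (P : T.Node → Prop) : List T.Node :=
  (Finset.univ.filter P).sort (· ≤ ·)

/-- The children of a node, in document order. -/
noncomputable def children (T : XMLTree Ele) (n : T.Node) : List T.Node :=
  T.listing (T.child n)

/-- The text content of a node: the values of its text children, concatenated in order. -/
noncomputable def textContent (T : XMLTree Ele) (n : T.Node) : String :=
  String.join ((T.children n).filterMap fun m => (T.label m).textValue)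

/-- `T` is an instance of the DTD `D`. -/
structure Conforms (T : XMLTree Ele) (D : DTD Ele) : Prop where
  root_iff : ∀ n, T.label n = .elem D.root ↔ n = T.root
  word_mem : ∀ n A, T.label n = .elem A →
    (T.children n).map (fun m => (T.label m).letter) ∈ (D.prod A).lang
  text_leaf : ∀ n s, T.label n = .text s → ∀ m, ¬ T.anc n m

end XMLTree

/-! ### XPath: the downward fragment and the extended fragment -/

/-- The label of a step: an element type, or `*`. -/
inductive NameTest (Ele : Type) : Type
  | name : Ele → NameTest Ele
  | any : NameTest Ele

/-- The test `*` accepts every element node; text nodes pass no test. -/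
def NameTest.Accepts {Ele : Type} : NameTest Ele → NodeLabel Ele → Prop
  | .name A, l => l = .elem A
  | .any, l => ∃ A, l = .elem A

/-- The axes `↓` and `↓⁺`. -/
inductive DownAxis : Type
  | child : DownAxis
  | desc : DownAxis

/-- The axes `ε`, `↓`, `↑`, `↓⁺`, `↑⁺`, `↑*`. -/
inductive Axis : Type
  | self : Axis
  | child : Axis
  | parent : Axis
  | desc : Axis
  | anc : Axis
  | ancOrSelf : Axis

def DownAxis.toAxis : DownAxis → Axis
  | .child => .child
  | .desc => .desc

/-- The node `m` lies on the given axis from the node `n`. -/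
def Axis.Reaches {Ele : Type} (T : XMLTree Ele) : Axis → T.Node → T.Node → Prop
  | .self, n, m => m = n
  | .child, n, m => T.child n m
  | .parent, n, m => T.child m n
  | .desc, n, m => T.anc n m
  | .anc, n, m => T.anc m n
  | .ancOrSelf, n, m => m = n ∨ T.anc m n

/-- The upward axes list nodes from the context node towards the root. -/
def Axis.isReverse : Axis → Bool
  | .parent => true
  | .anc => true
  | .ancOrSelf => true
  | _ => false

mutual

/-- Path expressions of the downward fragment. -/
inductive Path (Ele : Type) : Type
  | step : DownAxis → NameTest Ele → Path Ele
  | filter : Path Ele → Qual Ele → Path Ele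
  | seq : Path Ele → Path Ele → Path Ele
  | union : Path Ele → Path Ele → Path Ele

/-- Qualifiers of the downward fragment. -/
inductive Qual (Ele : Type) : Type
  | path : Path Ele → Qual Ele
  | eqText : Path Ele → String → Qual Ele
  | and : Qual Ele → Qual Ele → Qual Ele
  | or : Qual Ele → Qual Ele → Qual Ele
  | not : Qual Ele → Qual Ele

end

mutual

/-- Path expressions of the extended fragment: all six axes, and the position predicate
`path[k]`. -/
inductive EPath (Ele : Type) : Type
  | step : Axis → NameTest Ele → EPath Ele
  | filter : EPath Ele → EQual Ele → EPath Ele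
  | pos : EPath Ele → ℕ → EPath Ele
  | seq : EPath Ele → EPath Ele → EPath Ele
  | union : EPath Ele → EPath Ele → EPath Ele

/-- Qualifiers of the extended fragment; `eqNode p l` is the node comparison `p = ε::l`. -/
inductive EQual (Ele : Type) : Type
  | path : EPath Ele → EQual Ele
  | eqText : EPath Ele → String → EQual Ele
  | eqNode : EPath Ele → NameTest Ele → EQual Ele
  | and : EQual Ele → EQual Ele → EQual Ele
  | or : EQual Ele → EQual Ele → EQual Ele
  | not : EQual Ele → EQual Ele

end

mutual

/-- The downward fragment is a part of the extended fragment. -/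
def Path.toExt {Ele : Type} : Path Ele → EPath Ele
  | .step ax l => .step ax.toAxis l
  | .filter p q => .filter p.toExt q.toExt
  | .seq p q => .seq p.toExt q.toExt
  | .union p q => .union p.toExt q.toExt

def Qual.toExt {Ele : Type} : Qual Ele → EQual Ele
  | .path p => .path p.toExt
  | .eqText p c => .eqText p.toExt c
  | .and q r => .and q.toExt r.toExt
  | .or q r => .or q.toExt r.toExt
  | .not q => .not q.toExt

end

mutual

/-- The size of a query: the number of its axis steps and of its negations. -/
def Path.size {Ele : Type} : Path Ele → ℕ
  | .step _ _ => 1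
  | .filter p q => p.size + q.size
  | .seq p q => p.size + q.size
  | .union p q => p.size + q.size

def Qual.size {Ele : Type} : Qual Ele → ℕ
  | .path p => p.size
  | .eqText p _ => p.size
  | .and q r => q.size + r.size
  | .or q r => q.size + r.size
  | .not q => q.size + 1

end

open Classical in
/-- The nodes selected by `axis::label` at a node, in the order of the axis. -/
noncomputable def XMLTree.stepNodes {Ele : Type} (T : XMLTree Ele) (ax : Axis)
    (l : NameTest Ele) (n : T.Node) : List T.Node :=
  let s := T.listing fun m => ax.Reaches T n m ∧ l.Accepts (T.label m)
  if ax.isReverse then s.reverse else s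

/-- The `k`-th entry of a list, counted from `1`, as a list of length at most one. -/
def nth {α : Type} (l : List α) : ℕ → List α
  | 0 => []
  | k + 1 => l[k]?.toList

open Classical in
/-- The entries of a list that satisfy `P`, in the same order. -/
noncomputable def keep {α : Type} (P : α → Prop) (l : List α) : List α :=
  l.filter fun a => decide (P a)

mutual

/-- The nodes selected by a path expression at a context node, without repetition: a step is
listed in the order of its axis, a composition or a union in document order. -/
noncomputable def EPath.eval {Ele : Type} (T : XMLTree Ele) :
    EPath Ele → T.Node → List T.Node
  | .step ax l, n => T.stepNodes ax l n
  | .filter p q, n => keep (fun m => q.Sat T m) (p.eval T n)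
  | .pos p k, n => nth (p.eval T n) k
  | .seq p q, n => T.listing fun x => ∃ m, m ∈ p.eval T n ∧ x ∈ q.eval T m
  | .union p q, n => T.listing fun x => x ∈ p.eval T n ∨ x ∈ q.eval T n

/-- Validity of a qualifier at a node. Comparisons are existential: `p = c` asks for a selected
node with text content `c`, and `p = ε::l` for a node selected by both sides. -/
noncomputable def EQual.Sat {Ele : Type} (T : XMLTree Ele) : EQual Ele → T.Node → Prop
  | .path p, n => ∃ m, m ∈ p.eval T n
  | .eqText p c, n => ∃ m, m ∈ p.eval T n ∧ T.textContent m = c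
  | .eqNode p l, n => ∃ m, m ∈ p.eval T n ∧ m ∈ T.stepNodes .self l n
  | .and q r, n => q.Sat T n ∧ r.Sat T n
  | .or q r, n => q.Sat T n ∨ r.Sat T n
  | .not q, n => ¬ q.Sat T n

end

/-- `Q(T)`: the set of nodes selected by a query of the extended fragment at the root. -/
def EPath.answer {Ele : Type} (Q : EPath Ele) (T : XMLTree Ele) : Set T.Node :=
  {n | n ∈ Q.eval T T.root}

/-- `Q(T)` for a query of the downward fragment. -/
def Path.answer {Ele : Type} (Q : Path Ele) (T : XMLTree Ele) : Set T.Node :=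
  Q.toExt.answer T

/-! ### Access specifications, accessible nodes, and the view of a document -/

/-- The annotations `Y`, `N` and `[Q]`. -/
inductive Annotation (Ele : Type) : Type
  | yes : Annotation Ele
  | no : Annotation Ele
  | cond : Qual Ele → Annotation Ele

/-- An access specification: a DTD and a partial map `ann`, defined on some of the pairs
`(A, B)` where `B` occurs in the production of `A`. -/
structure AccessSpec (Ele : Type) where
  dtd : DTD Ele
  ann : Ele → Ele → Option (Annotation Ele)
  occurs_of_ann : ∀ A B v, ann A B = some v → (dtd.prod A).Occurs B

namespace AccessSpec

section

variable {Ele : Type}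

/-- The node `n` is concerned by the annotation `v`; the root is annotated with `Y`. -/
def Concerned (S : AccessSpec Ele) (T : XMLTree Ele) (n : T.Node) (v : Annotation Ele) : Prop :=
  (n = T.root ∧ v = .yes) ∨
  ∃ m A B, T.child m n ∧ T.label m = .elem A ∧ T.label n = .elem B ∧ S.ann A B = some v

/-- The node `n` is concerned by an annotation that is valid at `n`. -/
def ValidAt (S : AccessSpec Ele) (T : XMLTree Ele) (n : T.Node) : Prop :=
  S.Concerned T n .yes ∨ ∃ Q : Qual Ele, S.Concerned T n (.cond Q) ∧ Q.toExt.Sat T n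

/-- Accessibility of an element node: it is concerned by a valid annotation, or by none and its
first annotated ancestor is concerned by a valid one; and all conditions attached to its
ancestors hold. -/
def ElemAccessible (S : AccessSpec Ele) (T : XMLTree Ele) (n : T.Node) : Prop :=
  (S.ValidAt T n ∨
    ((¬ ∃ v, S.Concerned T n v) ∧
      ∃ a, T.anc a n ∧ S.ValidAt T a ∧
        ∀ b, T.anc a b → T.anc b n → ¬ ∃ v, S.Concerned T b v)) ∧
  ∀ a Q, T.anc a n → S.Concerned T a (.cond Q) → Q.toExt.Sat T a

/-- Accessibility of a node; a text node is accessible if and only if its parent is. -/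
def Accessible (S : AccessSpec Ele) (T : XMLTree Ele) (n : T.Node) : Prop :=
  match T.label n with
  | .elem _ => S.ElemAccessible T n
  | .text _ => ∃ m, T.child m n ∧ S.ElemAccessible T m

theorem accessible_root (S : AccessSpec Ele) (T : XMLTree Ele) (hT : T.Conforms S.dtd) :
    S.Accessible T T.root := by
  have h := (hT.root_iff T.root).2 rfl
  unfold Accessible
  rw [h]
  refine ⟨Or.inl (Or.inl (Or.inl ⟨rfl, rfl⟩)), ?_⟩
  intro a Q ha _
  have h1 := T.lt_of_anc ha
  have h2 := T.lt_of_anc (T.root_anc a h1.ne)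
  exact absurd h1 h2.asymm

open Classical in
/-- The view `T_v` of an instance: its nodes are the accessible nodes, with the ancestor relation
and the document order of `T`. So the parent of a node in `T_v` is its nearest accessible
ancestor. -/
noncomputable def view (S : AccessSpec Ele) (T : XMLTree Ele) (hT : T.Conforms S.dtd) :
    XMLTree Ele where
  Node := {n : T.Node // S.Accessible T n}
  root := ⟨T.root, S.accessible_root T hT⟩
  label n := T.label n.1
  anc m n := T.anc m.1 n.1
  anc_trans h h' := T.anc_trans h h'
  lt_of_anc h := T.lt_of_anc h
  anc_of_lt_of_lt h h1 h2 := T.anc_of_lt_of_lt h h1 h2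
  root_anc n h := T.root_anc n.1 fun e => h (Subtype.ext e)

/-! ### The DTD view -/

/-- `S.Exposes A access B`: the element type `B` occurs in the content model that the derivation of
the DTD view extracts for `A` under the inherited accessibility `access`. A visible subelement
type is kept; a hidden one is replaced by its own content model, extracted under the inherited
accessibility `false`. -/
inductive Exposes (S : AccessSpec Ele) : Ele → Bool → Ele → Prop
  | inherit {A B : Ele} : (S.dtd.prod A).Occurs B → S.ann A B = none → Exposes S A true B
  | yes {A B : Ele} {access : Bool} : S.ann A B = some .yes → Exposes S A access B
  | cond {A B : Ele} {access : Bool} {Q : Qual Ele} :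
      S.ann A B = some (.cond Q) → Exposes S A access B
  | hiddenInherit {A B C : Ele} : (S.dtd.prod A).Occurs B → S.ann A B = none →
      Exposes S B false C → Exposes S A false C
  | hiddenNo {A B C : Ele} {access : Bool} : S.ann A B = some .no →
      Exposes S B false C → Exposes S A access C

/-- `B` is a child type of `A` in the DTD view `D_v`. -/
def ViewChild (S : AccessSpec Ele) (A B : Ele) : Prop := S.Exposes A true B

/-- `Reach(↓, A)` and `Reach(↓⁺, A)`: the child types and the descendant types of `A` in `D_v`. -/
def Reach (S : AccessSpec Ele) : DownAxis → Ele → Ele → Prop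
  | .child => S.ViewChild
  | .desc => Relation.TransGen S.ViewChild

open Classical in
/-- The element types of `D_v`: the root type, and all types derived from it. -/
noncomputable def viewTypes [Fintype Ele] (S : AccessSpec Ele) : Finset Ele :=
  Finset.univ.filter (Relation.ReflTransGen S.ViewChild S.dtd.root)

/-! ### The accessibility predicates -/

/-- All triples `(A', A, v)` with `ann(A', A) = v`. -/
noncomputable def annList [Fintype Ele] (S : AccessSpec Ele) :
    List (Ele × Ele × Annotation Ele) :=
  (Finset.univ : Finset (Ele × Ele)).toList.filterMap fun x =>
    (S.ann x.1 x.2).map fun v => (x.1, x.2, v)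

/-- `ε::root ∨ ⋁_{ann(A',A) ∈ ann} ε::A/↑::A'` -/
noncomputable def annotatedQual [Fintype Ele] (S : AccessSpec Ele) : EQual Ele :=
  S.annList.foldr
    (fun x q => .or (.path (.seq (.step .self (.name x.2.1)) (.step .parent (.name x.1)))) q)
    (.path (.step .self (.name S.dtd.root)))

/-- `ε::root ∨ ⋁_{ann(A',A) = Y | [Q]} ε::A.σ(A',A)/↑::A'`, where `A.σ(A',A)` is `A[Q]` for the
annotation `[Q]`, and `A` for `Y` -/
noncomputable def validQual [Fintype Ele] (S : AccessSpec Ele) : EQual Ele :=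
  S.annList.foldr
    (fun x q =>
      match x with
      | (A', A, .yes) => .or (.path (.seq (.step .self (.name A)) (.step .parent (.name A')))) q
      | (A', A, .cond Q) =>
        .or (.path (.seq (.filter (.step .self (.name A)) Q.toExt) (.step .parent (.name A')))) q
      | (_, _, .no) => q)
    (.path (.step .self (.name S.dtd.root)))

/-- `𝒜₁ᵃᶜᶜ`, the predicate `↑*::*[annotated][1][valid]` -/
noncomputable def acc₁ [Fintype Ele] (S : AccessSpec Ele) : EQual Ele :=
  .path (.filter (.pos (.filter (.step .ancOrSelf .any) S.annotatedQual) 1) S.validQual)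

/-- `𝒜₂ᵃᶜᶜ`, the predicate `⋀_{ann(A',A) = [Q]} not(↑⁺::A[not(Q)]/↑::A')`; the empty conjunction
is written `ε::*`, which holds at every element node. -/
noncomputable def acc₂ [Fintype Ele] (S : AccessSpec Ele) : EQual Ele :=
  S.annList.foldr
    (fun x q =>
      match x with
      | (A', A, .cond Q) =>
        .and (.not (.path (.seq (.filter (.step .anc (.name A)) (.not Q.toExt))
          (.step .parent (.name A'))))) q
      | _ => q)
    (.path (.step .self .any))

/-- `𝒜ᵃᶜᶜ`, the conjunction of `𝒜₁ᵃᶜᶜ` and `𝒜₂ᵃᶜᶜ` -/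
noncomputable def acc [Fintype Ele] (S : AccessSpec Ele) : EQual Ele :=
  .and S.acc₁ S.acc₂

/-- `𝒜⁺`, the path `↑⁺::*[𝒜₁ᵃᶜᶜ]` -/
noncomputable def accPlus [Fintype Ele] (S : AccessSpec Ele) : EPath Ele :=
  .filter (.step .anc .any) S.acc₁

/-- `𝒜ᴮ`, the predicate `𝒜⁺[1]/ε::B` -/
noncomputable def accParent [Fintype Ele] (S : AccessSpec Ele) (B : Ele) : EQual Ele :=
  .path (.seq (.pos S.accPlus 1) (.step .self (.name B)))

end

end AccessSpec

/-! ### Step counting -/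

/-- A computation with the number of elementary steps that it takes. -/
structure Timed (α : Type) where
  val : α
  time : ℕ

instance : Monad Timed where
  pure a := ⟨a, 0⟩
  bind x f := ⟨(f x.val).val, x.time + (f x.val).time⟩

/-- Spend `k` steps. -/
def ticks (k : ℕ) : Timed Unit := ⟨(), k⟩

/-! ### The algorithm `Rewrite`

One step is charged for each visit of a node of the query, for each constructor of a path
expression or qualifier that is created, for each look-up in the tables, and for each turn of a
loop over a list of element types. No expression that was built is used twice. -/

/-- The data prepared once for a security view: the element types of `D_v`, its relation `Reach`
as a table, and the expressions `𝒜ᵃᶜᶜ` and `𝒜⁺`, which are available as single symbols. -/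
structure Tables (Ele : Type) where
  types : List Ele
  reach : DownAxis → Ele → Ele → Bool
  acc : EQual Ele
  accPlus : EPath Ele

/-- The result of rewriting a predicate. -/
inductive Verdict (Ele : Type) : Type
  | ff : Verdict Ele
  | tt : Verdict Ele
  | qual : EQual Ele → Verdict Ele

/-- What the algorithm knows after processing a query `p` from context nodes with types in a list
`L`: the list `reach` of the possible types of the nodes selected by `p`; the rewritten filters
of the last step; the expression `back` (the paths `prefix⁻¹`) that leads from a selected node
back to the context nodes; and whether `p` is a single step along `↓⁺`. -/
structure Trail (Ele : Type) where
  reach : List Ele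
  filters : List (EQual Ele)
  back : EPath Ele
  single : Bool

section

variable {Ele : Type}

/-- The query that selects nothing, `ε::*[not(ε::*)]`. -/
def emptyPath : EPath Ele :=
  .filter (.step .self .any) (.not (.path (.step .self .any)))

/-- `fs({E₁,…,Eₙ}, axis)`, the union `axis::E₁ ∪ … ∪ axis::Eₙ`. -/
def fusion (ax : Axis) : List Ele → Timed (EPath Ele)
  | [] => do
    ticks 4
    pure emptyPath
  | [E] => do
    ticks 1
    pure (.step ax (.name E))
  | E :: L => do
    ticks 2
    let p ← fusion ax L
    pure (.union (.step ax (.name E)) p)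

/-- `p[q₁]…[qₙ]`. -/
def applyFilters (p : EPath Ele) : List (EQual Ele) → Timed (EPath Ele)
  | [] => pure p
  | q :: qs => do
    ticks 1
    applyFilters (.filter p q) qs

/-- Is there an `E` in the list with `B ∈ Reach(axis, E)`? -/
def someReach (tab : Tables Ele) (ax : DownAxis) (B : Ele) : List Ele → Timed Bool
  | [] => pure false
  | E :: L => do
    ticks 1
    if tab.reach ax E B then pure true else someReach tab ax B L

/-- Elimination of the label `*`: those of the given types that lie in `⋃_{E ∈ L} Reach(axis, E)`. -/
def starReach (tab : Tables Ele) (ax : DownAxis) (L : List Ele) : List Ele → Timed (List Ele)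
  | [] => pure []
  | B :: Bs => do
    ticks 1
    let b ← someReach tab ax B L
    let R ← starReach tab ax L Bs
    pure (if b then B :: R else R)

/-- The types reached from types in `L` by the step `axis::label`. -/
def stepReach (tab : Tables Ele) (ax : DownAxis) (L : List Ele) :
    NameTest Ele → Timed (List Ele)
  | .any => starReach tab ax L tab.types
  | .name E => do
    let b ← someReach tab ax E L
    pure (if b then [E] else [])

/-- Membership in a list of element types. -/
def memList [DecidableEq Ele] (x : Ele) : List Ele → Timed Bool
  | [] => pure false
  | y :: L => do
    ticks 1
    if x = y then pure true else memList x L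

/-- Union of two lists of element types. -/
def unionList [DecidableEq Ele] : List Ele → List Ele → Timed (List Ele)
  | [], M => pure M
  | x :: L, M => do
    ticks 1
    let b ← memList x M
    let R ← unionList L M
    pure (if b then R else x :: R)

/-- One step `axis::label` from context nodes with types in `L`; `none` if no type is reached. The
way back is `𝒜^{fs(L,ε)}`, which is `𝒜⁺[1]/fs(L,ε)`, for `↓`, and `fs(L,↑⁺)[𝒜ᵃᶜᶜ]` for `↓⁺`. -/
def stepTrail (tab : Tables Ele) (ax : DownAxis) (l : NameTest Ele) (L : List Ele) :
    Timed (Option (Trail Ele)) := do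
  ticks 1
  let R ← stepReach tab ax L l
  if R.isEmpty then
    pure none
  else
    match ax with
    | .child => do
      let e ← fusion .self L
      ticks 2
      pure (some ⟨R, [], .seq (.pos tab.accPlus 1) e, false⟩)
    | .desc => do
      let e ← fusion .anc L
      ticks 1
      pure (some ⟨R, [], .filter e tab.acc, true⟩)

/-- Attach a rewritten filter to the last step; `none` if the filter is invalid. -/
def addFilter (t : Trail Ele) : Verdict Ele → Option (Trail Ele)
  | .ff => none
  | .tt => some t
  | .qual q => some { t with filters := q :: t.filters }

/-- Composition: the way back through the second path ends at nodes that pass the filters of the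
first path, and goes on through the first path. -/
def seqTrail (t₁ t₂ : Trail Ele) : Timed (Trail Ele) := do
  let b ← applyFilters t₂.back t₁.filters
  ticks 1
  pure ⟨t₂.reach, t₂.filters, .seq b t₁.back, false⟩

/-- The way back through one member of a union, preceded by the tests of that member. -/
def branch (t : Trail Ele) : Timed (EPath Ele) := do
  let e ← fusion .self t.reach
  let b ← applyFilters e t.filters
  ticks 1
  pure (.seq b t.back)

/-- A union that is a proper part of a path; a member that is rejected is left out. -/
def unionTrail [DecidableEq Ele] : Option (Trail Ele) → Option (Trail Ele) →
    Timed (Option (Trail Ele))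
  | none, t => pure t
  | t, none => pure t
  | some t₁, some t₂ => do
    let R ← unionList t₁.reach t₂.reach
    let b₁ ← branch t₁
    let b₂ ← branch t₂
    ticks 1
    pure (some ⟨R, [], .union b₁ b₂, false⟩)

/-- The predicate `fs(reach,↓⁺)[𝒜ᵃᶜᶜ][filters][extra]/back = ε::*`; the comparison is omitted after
a single step along `↓⁺`. -/
def closePred (tab : Tables Ele) (t : Trail Ele) (extra : List (EQual Ele)) :
    Timed (Verdict Ele) := do
  let e ← fusion .desc t.reach
  ticks 1
  let e₁ ← applyFilters (.filter e tab.acc) t.filters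
  let e₂ ← applyFilters e₁ extra
  if t.single then do
    ticks 1
    pure (.qual (.path e₂))
  else do
    ticks 2
    pure (.qual (.eqNode (.seq e₂ t.back) .any))

/-- The optional content test `[ε::* = c]`. -/
def textTest : Option String → Timed (List (EQual Ele))
  | none => pure []
  | some c => do
    ticks 2
    pure [.eqText (.step .self .any) c]

/-- Conjunction of rewritten predicates. -/
def andVerdict : Verdict Ele → Verdict Ele → Timed (Verdict Ele)
  | .ff, _ => pure .ff
  | _, .ff => pure .ff
  | .tt, v => pure v
  | v, .tt => pure v
  | .qual q, .qual r => do
    ticks 1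
    pure (.qual (.and q r))

/-- Disjunction of rewritten predicates. -/
def orVerdict : Verdict Ele → Verdict Ele → Timed (Verdict Ele)
  | .tt, _ => pure .tt
  | _, .tt => pure .tt
  | .ff, v => pure v
  | v, .ff => pure v
  | .qual q, .qual r => do
    ticks 1
    pure (.qual (.or q r))

/-- Negation of a rewritten predicate. -/
def notVerdict : Verdict Ele → Timed (Verdict Ele)
  | .ff => pure .tt
  | .tt => pure .ff
  | .qual q => do
    ticks 1
    pure (.qual (.not q))

mutual

/-- Process a path from context nodes with types in `L`; `none` if the path is rejected. -/
def trail [DecidableEq Ele] (tab : Tables Ele) :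
    Path Ele → List Ele → Timed (Option (Trail Ele))
  | .step ax l, L => stepTrail tab ax l L
  | .filter p q, L => do
    ticks 1
    let t ← trail tab p L
    match t with
    | none => pure none
    | some t => do
      let v ← rwPred tab q t.reach
      pure (addFilter t v)
  | .seq p q, L => do
    ticks 1
    let t ← trail tab p L
    match t with
    | none => pure none
    | some t₁ => do
      let t' ← trail tab q t₁.reach
      match t' with
      | none => pure none
      | some t₂ => do
        let s ← seqTrail t₁ t₂
        pure (some s)
  | .union p q, L => do
    ticks 1
    let t₁ ← trail tab p L
    let t₂ ← trail tab q L
    unionTrail t₁ t₂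

/-- Rewrite the predicate `p`, or `p = c`, over the element types in `L`. A path `q_f/q_r` becomes
the rewriting of `q_f` with the rewriting of `q_r` as a filter. -/
def rwPath [DecidableEq Ele] (tab : Tables Ele) :
    Path Ele → Option String → List Ele → Timed (Verdict Ele)
  | .step ax l, c, L => do
    ticks 1
    let t ← stepTrail tab ax l L
    match t with
    | none => pure .ff
    | some t => do
      let x ← textTest c
      closePred tab t x
  | .filter p q, c, L => do
    ticks 1
    let t ← trail tab p L
    match t with
    | none => pure .ff
    | some t => do
      let v ← rwPred tab q t.reach
      match addFilter t v with
      | none => pure .ff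
      | some t => do
        let x ← textTest c
        closePred tab t x
  | .seq p q, c, L => do
    ticks 1
    let t ← trail tab p L
    match t with
    | none => pure .ff
    | some t => do
      let v ← rwPath tab q c t.reach
      match addFilter t v with
      | none => pure .ff
      | some t => closePred tab t []
  | .union p q, c, L => do
    ticks 1
    let v ← rwPath tab p c L
    let w ← rwPath tab q c L
    orVerdict v w

/-- `RW_Pred`: rewrite a predicate over the element types in `L`. -/
def rwPred [DecidableEq Ele] (tab : Tables Ele) :
    Qual Ele → List Ele → Timed (Verdict Ele)
  | .path p, L => do
    ticks 1
    rwPath tab p none L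
  | .eqText p c, L => do
    ticks 1
    rwPath tab p (some c) L
  | .and q r, L => do
    ticks 1
    let v ← rwPred tab q L
    let w ← rwPred tab r L
    andVerdict v w
  | .or q r, L => do
    ticks 1
    let v ← rwPred tab q L
    let w ← rwPred tab r L
    orVerdict v w
  | .not q, L => do
    ticks 1
    let v ← rwPred tab q L
    notVerdict v

end

/-- The rewritten query `fs(reach,↓⁺)[𝒜ᵃᶜᶜ][filters][back]`; the empty query if the path is
rejected. -/
def closeQuery (tab : Tables Ele) : Option (Trail Ele) → Timed (EPath Ele)
  | none => do
    ticks 4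
    pure emptyPath
  | some t => do
    let e ← fusion .desc t.reach
    ticks 1
    let e₁ ← applyFilters (.filter e tab.acc) t.filters
    ticks 2
    pure (.filter e₁ (.path t.back))

/-- `Rewrite(p, A)`: rewrite the query `p` for a context node of type `A`. -/
def rewriteFrom [DecidableEq Ele] (tab : Tables Ele) : Path Ele → Ele → Timed (EPath Ele)
  | .union p q, A => do
    ticks 1
    let e ← rewriteFrom tab p A
    let e' ← rewriteFrom tab q A
    ticks 1
    pure (.union e e')
  | p, A => do
    let t ← trail tab p [A]
    closeQuery tab t

end

open Classical in
/-- The tables of the security view of `S`. -/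
noncomputable def AccessSpec.tables {Ele : Type} [Fintype Ele] (S : AccessSpec Ele) :
    Tables Ele where
  types := S.viewTypes.toList
  reach ax A B := decide (S.Reach ax A B)
  acc := S.acc
  accPlus := S.accPlus

/-- `Rewrite` for the security view of `S`, with the root type as context. -/
noncomputable def AccessSpec.rewrite {Ele : Type} [Fintype Ele] [DecidableEq Ele]
    (S : AccessSpec Ele) (Q : Path Ele) : Timed (EPath Ele) :=
  rewriteFrom S.tables Q S.dtd.root

end SecureXML

/-!
Correctness and cost of the rewriting of downward XPath queries over a security view.

The accessibility predicates. Every node is concerned by at most one annotation, so "the nearest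
annotated ancestor-or-self carries a valid annotation" is expressed by an upward step followed by
the position predicate `[1]`, and `𝒜ᵃᶜᶜ` is a literal transcription of conditions (i) and (ii) of
accessibility (`acc_sat`). The path `𝒜⁺` tests condition (i) only: condition (ii) at an accessible
node entails condition (ii) at all its ancestors, so the first node selected by `𝒜⁺` from an
accessible node is its parent in the view (`mem_eval_accPlus_first`).

The table of the DTD view is complete: between a node of the view and its parent in the view lie
only hidden nodes, none of which has a failing condition, and walking down through them follows a
derivation of `Exposes` (`exposes_of_anc`). Hence each node reached by a step in the view has a type
that the table offers (`typeIn_stepReach`). The table may also offer types that do not occur; this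
does no harm, since the way back decides.

Correctness of the rewriting is an induction over the syntax. The invariant (`TrailSound`) says that
a node of the view is selected from a context node exactly if it has a reached type, passes the
pending filters, and leads back to the context node in the document; and that from any node of a
reached type the way back ends at accessible nodes with a context type only. The second half is what
makes ways back composable. The nodes of the view selected by a path are proper descendants
of the context node, so searching the accessible descendants and testing the way back
(`verdictSound_closePred`, `mem_closeQuery_trail`) recovers the answer. Text comparisons agree
because an accessible element has the same text children in the document and in the view
(`textContent_view`).

The running time is an amortized count. Type lists have no repetitions and lie in the view, so each
loop costs `O(|D_v|²)`. A pending filter is written once, and its cost is charged when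
it is created. The nodes of the syntax tree other than steps and negations are paid for by a
multiple of `|D_v|²` that each subexpression leaves unspent (`trail_spec`, `time_rwPath_le`,
`time_rwPred_le`).
-/

namespace SecureXML

/-! ### Trees and their listings -/

namespace XMLTree

variable {Ele : Type}

theorem mem_listing (T : XMLTree Ele) {P : T.Node → Prop} {x : T.Node} :
    x ∈ T.listing P ↔ P x := by
  simp [listing]

theorem pairwise_listing (T : XMLTree Ele) (P : T.Node → Prop) :
    (T.listing P).Pairwise (· < ·) :=
  (Finset.sortedLT_sort _).pairwise

theorem mem_stepNodes (T : XMLTree Ele) {ax : Axis} {l : NameTest Ele} {n x : T.Node} :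
    x ∈ T.stepNodes ax l n ↔ ax.Reaches T n x ∧ l.Accepts (T.label x) := by
  unfold stepNodes
  cases ax.isReverse <;> simp [mem_listing]

theorem pairwise_stepNodes_of_isReverse (T : XMLTree Ele) {ax : Axis} (h : ax.isReverse = true)
    (l : NameTest Ele) (n : T.Node) : (T.stepNodes ax l n).Pairwise (· > ·) := by
  unfold stepNodes
  simp only [h, if_true]
  exact List.pairwise_reverse.2 (T.pairwise_listing _)

theorem anc_irrefl (T : XMLTree Ele) (a : T.Node) : ¬ T.anc a a :=
  fun h => (T.lt_of_anc h).false

theorem not_anc_root (T : XMLTree Ele) (a : T.Node) : ¬ T.anc a T.root := fun h => by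
  by_cases e : a = T.root
  · subst e
    exact T.anc_irrefl _ h
  · exact T.anc_irrefl _ (T.anc_trans h (T.root_anc a e))

/-- The ancestors of a node form a chain. -/
theorem anc_trichotomy (T : XMLTree Ele) {a b c : T.Node} (ha : T.anc a c) (hb : T.anc b c) :
    T.anc a b ∨ a = b ∨ T.anc b a := by
  rcases lt_trichotomy a b with h | h | h
  · exact Or.inl (T.anc_of_lt_of_lt ha h (T.lt_of_anc hb))
  · exact Or.inr (Or.inl h)
  · exact Or.inr (Or.inr (T.anc_of_lt_of_lt hb h (T.lt_of_anc ha)))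

theorem child_unique (T : XMLTree Ele) {a b c : T.Node} (ha : T.child a c) (hb : T.child b c) :
    a = b := by
  rcases T.anc_trichotomy ha.1 hb.1 with h | h | h
  · exact absurd ⟨b, h, hb.1⟩ ha.2
  · exact h
  · exact absurd ⟨a, h, ha.1⟩ hb.2

/-- Among the ancestors of `n` with a property, there is one nearest to `n`. -/
theorem exists_nearest_anc (T : XMLTree Ele) {n : T.Node} (P : T.Node → Prop)
    (h : ∃ a, T.anc a n ∧ P a) :
    ∃ a, T.anc a n ∧ P a ∧ ∀ b, T.anc a b → T.anc b n → ¬ P b := by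
  classical
  obtain ⟨a, ha, hmax⟩ := (Finset.univ.filter fun a => T.anc a n ∧ P a).exists_max_image id
    (by obtain ⟨a, h⟩ := h; exact ⟨a, by simpa using h⟩)
  simp only [Finset.mem_filter, Finset.mem_univ, true_and, id] at ha hmax
  exact ⟨a, ha.1, ha.2, fun b hab hbn hb => (T.lt_of_anc hab).not_ge (hmax b ⟨hbn, hb⟩)⟩

theorem exists_parent (T : XMLTree Ele) {n : T.Node} (h : n ≠ T.root) : ∃ m, T.child m n := by
  obtain ⟨a, ha, -, hmax⟩ := T.exists_nearest_anc (n := n) (fun _ => True)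
    ⟨T.root, T.root_anc n h, trivial⟩
  exact ⟨a, ha, fun ⟨k, h1, h2⟩ => hmax k h1 h2 trivial⟩

/-- The first node on the way from an ancestor `a` down to `n`. -/
theorem exists_child_toward (T : XMLTree Ele) {a n : T.Node} (h : T.anc a n) :
    ∃ k, T.child a k ∧ (k = n ∨ T.anc k n) := by
  classical
  obtain ⟨k, hk, hmin⟩ := (Finset.univ.filter fun k =>
    T.anc a k ∧ (k = n ∨ T.anc k n)).exists_min_image id ⟨n, by simp [h]⟩
  simp only [Finset.mem_filter, Finset.mem_univ, true_and, id] at hk hmin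
  refine ⟨k, ⟨hk.1, ?_⟩, hk.2⟩
  rintro ⟨j, haj, hjk⟩
  refine (T.lt_of_anc hjk).not_ge (hmin j ⟨haj, Or.inr ?_⟩)
  rcases hk.2 with rfl | h
  · exact hjk
  · exact T.anc_trans hjk h

variable {D : DTD Ele} {T : XMLTree Ele}

theorem Conforms.exists_elem_of_anc (hT : T.Conforms D) {a n : T.Node} (h : T.anc a n) :
    ∃ A, T.label a = .elem A := by
  cases e : T.label a with
  | elem A => exact ⟨A, rfl⟩
  | text s => exact absurd h (hT.text_leaf a s e n)

/-- An element type that occurs in a word of a content model occurs in the content model. -/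
theorem _root_.SecureXML.ContentModel.occurs_of_mem_lang (α : ContentModel Ele) :
    ∀ {w : List (Option Ele)} {B : Ele}, w ∈ α.lang → some B ∈ w → α.Occurs B := by
  induction α with
  | str =>
    intro w B hw hB
    have hw : w = [none] := hw
    simp [hw] at hB
  | eps =>
    intro w B hw hB
    have hw : w = [] := hw
    simp [hw] at hB
  | elem A =>
    intro w B hw hB
    have hw : w = [some A] := hw
    simp only [hw, List.mem_singleton, Option.some.injEq] at hB
    exact hB.symm
  | concat a b iha ihb =>
    intro w B hw hB
    obtain ⟨u, hu, v, hv, rfl⟩ := Language.mem_mul.1 hw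
    rcases List.mem_append.1 hB with h | h
    · exact Or.inl (iha hu h)
    · exact Or.inr (ihb hv h)
  | alt a b iha ihb =>
    intro w B hw hB
    rcases (Language.mem_add _ _ _).1 hw with h | h
    · exact Or.inl (iha h hB)
    · exact Or.inr (ihb h hB)
  | star a iha =>
    intro w B hw hB
    obtain ⟨L, rfl, hL⟩ := Language.mem_kstar.1 hw
    obtain ⟨u, hu, hBu⟩ := List.mem_flatten.1 hB
    exact iha (hL u hu) hBu

theorem Conforms.occurs_of_child (hT : T.Conforms D) {m n : T.Node} {A B : Ele}
    (h : T.child m n) (hA : T.label m = .elem A) (hB : T.label n = .elem B) :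
    (D.prod A).Occurs B := by
  refine (D.prod A).occurs_of_mem_lang (hT.word_mem m A hA) ?_
  exact List.mem_map.2 ⟨n, T.mem_listing.2 h, by rw [hB]; rfl⟩

end XMLTree

/-! ### Membership in the result of an expression -/

section

variable {Ele : Type}

theorem mem_keep {α : Type} {P : α → Prop} {l : List α} {a : α} : a ∈ keep P l ↔ a ∈ l ∧ P a := by
  simp [keep]

theorem mem_nth_one_iff {α : Type} [LinearOrder α] {l : List α} (h : l.Pairwise (· > ·)) {x : α} :
    x ∈ nth l 1 ↔ x ∈ l ∧ ∀ y ∈ l, y ≤ x := by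
  cases l with
  | nil => simp [nth]
  | cons a l =>
    have ha : ∀ {y}, y ∈ l → a > y := List.rel_of_pairwise_cons h
    simp only [nth, List.getElem?_cons_zero, Option.toList_some, List.mem_singleton]
    constructor
    · rintro rfl
      refine ⟨by simp, fun y hy => ?_⟩
      rcases List.mem_cons.1 hy with rfl | hy
      · exact le_rfl
      · exact (ha hy).le
    · rintro ⟨hx, hmax⟩
      rcases List.mem_cons.1 hx with rfl | hx
      · rfl
      · exact absurd (hmax a (by simp)) (ha hx).not_ge

namespace EPath

variable (T : XMLTree Ele)

theorem mem_eval_step {ax : Axis} {l : NameTest Ele} {n x : T.Node} :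
    x ∈ (EPath.step ax l).eval T n ↔ ax.Reaches T n x ∧ l.Accepts (T.label x) := by
  rw [EPath.eval, T.mem_stepNodes]

theorem mem_eval_filter {p : EPath Ele} {q : EQual Ele} {n x : T.Node} :
    x ∈ (EPath.filter p q).eval T n ↔ x ∈ p.eval T n ∧ q.Sat T x := by
  rw [EPath.eval, mem_keep]

theorem mem_eval_seq {p q : EPath Ele} {n x : T.Node} :
    x ∈ (EPath.seq p q).eval T n ↔ ∃ m, m ∈ p.eval T n ∧ x ∈ q.eval T m := by
  rw [EPath.eval, T.mem_listing]

theorem mem_eval_union {p q : EPath Ele} {n x : T.Node} :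
    x ∈ (EPath.union p q).eval T n ↔ x ∈ p.eval T n ∨ x ∈ q.eval T n := by
  rw [EPath.eval, T.mem_listing]

/-- The first node on an upward axis that passes a filter is the nearest one, that is, the last in
document order. -/
theorem mem_eval_first {ax : Axis} (hax : ax.isReverse = true) {l : NameTest Ele}
    {q : EQual Ele} {n x : T.Node} :
    x ∈ (EPath.pos (.filter (.step ax l) q) 1).eval T n ↔
      (ax.Reaches T n x ∧ l.Accepts (T.label x) ∧ q.Sat T x) ∧
        ∀ y, ax.Reaches T n y → l.Accepts (T.label y) → q.Sat T y → y ≤ x := by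
  have h : (keep (fun m => q.Sat T m) ((EPath.step ax l).eval T n)).Pairwise (· > ·) := by
    rw [EPath.eval]
    exact (T.pairwise_stepNodes_of_isReverse hax l n).filter _
  rw [EPath.eval, EPath.eval, mem_nth_one_iff h]
  simp only [mem_keep, mem_eval_step, and_assoc, and_imp]

end EPath

theorem mem_eval_emptyPath (T : XMLTree Ele) {n x : T.Node} :
    ¬ x ∈ (emptyPath : EPath Ele).eval T n := by
  unfold emptyPath
  rw [EPath.mem_eval_filter, EPath.mem_eval_step, EQual.Sat, EQual.Sat]
  rintro ⟨⟨-, h⟩, h'⟩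
  exact h' ⟨x, (EPath.mem_eval_step T).2 ⟨rfl, h⟩⟩

end

/-! ### The accessibility predicates -/

namespace AccessSpec

variable {Ele : Type} (S : AccessSpec Ele) {T : XMLTree Ele}

/-- Condition (i) of accessibility: the nearest annotated ancestor-or-self of `n` is concerned by
a valid annotation. -/
def InheritsValid (T : XMLTree Ele) (n : T.Node) : Prop :=
  S.ValidAt T n ∨
    ((¬ ∃ v, S.Concerned T n v) ∧
      ∃ a, T.anc a n ∧ S.ValidAt T a ∧
        ∀ b, T.anc a b → T.anc b n → ¬ ∃ v, S.Concerned T b v)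

/-- Condition (ii) of accessibility: all conditions attached to proper ancestors of `n` hold. -/
def AncConds (T : XMLTree Ele) (n : T.Node) : Prop :=
  ∀ a Q, T.anc a n → S.Concerned T a (.cond Q) → Q.toExt.Sat T a

variable {S}

theorem elemAccessible_iff {n : T.Node} :
    S.ElemAccessible T n ↔ S.InheritsValid T n ∧ S.AncConds T n := Iff.rfl

theorem accessible_iff_of_elem {n : T.Node} {A : Ele} (h : T.label n = .elem A) :
    S.Accessible T n ↔ S.ElemAccessible T n := by
  unfold Accessible
  rw [h]

theorem accessible_iff_of_text {n : T.Node} {s : String} (h : T.label n = .text s) :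
    S.Accessible T n ↔ ∃ m, T.child m n ∧ S.ElemAccessible T m := by
  unfold Accessible
  rw [h]

theorem AncConds.of_anc {a n : T.Node} (h : S.AncConds T n) (ha : T.anc a n) : S.AncConds T a :=
  fun b Q hb hc => h b Q (T.anc_trans hb ha) hc

/-- A node is concerned by at most one annotation. -/
theorem Concerned.unique {n : T.Node} {v w : Annotation Ele} (hv : S.Concerned T n v)
    (hw : S.Concerned T n w) : v = w := by
  rcases hv with ⟨rfl, rfl⟩ | ⟨m, A, B, hm, hA, hB, hv⟩ <;>
    rcases hw with ⟨h, rfl⟩ | ⟨m', A', B', hm', hA', hB', hw⟩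
  · rfl
  · exact absurd hm'.1 (T.not_anc_root _)
  · subst h
    exact absurd hm.1 (T.not_anc_root _)
  · obtain rfl := T.child_unique hm hm'
    rw [hA] at hA'
    rw [hB] at hB'
    cases hA'
    cases hB'
    rw [hv] at hw
    exact Option.some.inj hw

theorem concerned_iff_of_child {m n : T.Node} {A B : Ele} (h : T.child m n)
    (hA : T.label m = .elem A) (hB : T.label n = .elem B) {v : Annotation Ele} :
    S.Concerned T n v ↔ S.ann A B = some v := by
  constructor
  · rintro (⟨rfl, -⟩ | ⟨m', A', B', hm', hA', hB', hv⟩)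
    · exact absurd h.1 (T.not_anc_root _)
    · obtain rfl := T.child_unique h hm'
      rw [hA] at hA'
      rw [hB] at hB'
      cases hA'
      cases hB'
      exact hv
  · exact fun hv => Or.inr ⟨m, A, B, h, hA, hB, hv⟩

theorem ValidAt.concerned {n : T.Node} (h : S.ValidAt T n) : ∃ v, S.Concerned T n v := by
  rcases h with h | ⟨Q, h, -⟩
  · exact ⟨_, h⟩
  · exact ⟨_, h⟩

theorem inheritsValid_iff_validAt {n : T.Node} (h : ∃ v, S.Concerned T n v) :
    S.InheritsValid T n ↔ S.ValidAt T n :=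
  ⟨fun h' => h'.elim id fun h'' => absurd h h''.1, Or.inl⟩

/-- An unannotated node inherits its status from its parent. -/
theorem inheritsValid_iff_of_child {m n : T.Node} (h : T.child m n)
    (hn : ¬ ∃ v, S.Concerned T n v) : S.InheritsValid T n ↔ S.InheritsValid T m := by
  constructor
  · rintro (h' | ⟨-, a, han, hva, hb⟩)
    · exact absurd h'.concerned hn
    · rcases T.anc_trichotomy han h.1 with ham | rfl | hma
      · exact Or.inr ⟨hb m ham h.1, a, ham, hva,
          fun b hab hbm => hb b hab (T.anc_trans hbm h.1)⟩
      · exact Or.inl hva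
      · exact absurd ⟨a, hma, han⟩ h.2
  · rintro (h' | ⟨hm, a, ham, hva, hb⟩)
    · exact Or.inr ⟨hn, m, h.1, h', fun b hmb hbn => absurd ⟨b, hmb, hbn⟩ h.2⟩
    · refine Or.inr ⟨hn, a, T.anc_trans ham h.1, hva, fun b hab hbn => ?_⟩
      rcases T.anc_trichotomy hbn h.1 with hbm | rfl | hmb
      · exact hb b hab hbm
      · exact hm
      · exact absurd ⟨b, hmb, hbn⟩ h.2

theorem sat_self_name {A : Ele} {n : T.Node} :
    (EQual.path (.step .self (.name A))).Sat T n ↔ T.label n = .elem A := by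
  rw [EQual.Sat]
  simp only [EPath.mem_eval_step, Axis.Reaches, NameTest.Accepts]
  constructor
  · rintro ⟨m, rfl, h⟩
    exact h
  · exact fun h => ⟨n, rfl, h⟩

theorem sat_self_any {n : T.Node} :
    (EQual.path (.step .self .any)).Sat T n ↔ ∃ A : Ele, T.label n = .elem A := by
  rw [EQual.Sat]
  simp only [EPath.mem_eval_step, Axis.Reaches, NameTest.Accepts]
  constructor
  · rintro ⟨m, rfl, h⟩
    exact h
  · exact fun h => ⟨n, rfl, h⟩

theorem sat_self_parent {A A' : Ele} {n : T.Node} :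
    (EQual.path (.seq (.step .self (.name A)) (.step .parent (.name A')))).Sat T n ↔
      ∃ m, T.child m n ∧ T.label m = .elem A' ∧ T.label n = .elem A := by
  rw [EQual.Sat]
  simp only [EPath.mem_eval_seq, EPath.mem_eval_step, Axis.Reaches, NameTest.Accepts]
  constructor
  · rintro ⟨m, k, ⟨rfl, h1⟩, h2, h3⟩
    exact ⟨m, h2, h3, h1⟩
  · rintro ⟨m, h1, h2, h3⟩
    exact ⟨m, n, ⟨rfl, h3⟩, h1, h2⟩

theorem sat_self_cond_parent {A A' : Ele} {q : EQual Ele} {n : T.Node} :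
    (EQual.path (.seq (.filter (.step .self (.name A)) q) (.step .parent (.name A')))).Sat T n ↔
      (∃ m, T.child m n ∧ T.label m = .elem A' ∧ T.label n = .elem A) ∧ q.Sat T n := by
  rw [EQual.Sat]
  simp only [EPath.mem_eval_seq, EPath.mem_eval_filter, EPath.mem_eval_step, Axis.Reaches,
    NameTest.Accepts]
  constructor
  · rintro ⟨m, k, ⟨⟨rfl, h1⟩, hq⟩, h2, h3⟩
    exact ⟨⟨m, h2, h3, h1⟩, hq⟩
  · rintro ⟨⟨m, h1, h2, h3⟩, hq⟩
    exact ⟨m, n, ⟨⟨rfl, h3⟩, hq⟩, h1, h2⟩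

/-- The annotation `v`, seen as a test of the annotated node, holds at `n`. -/
def _root_.SecureXML.Annotation.HoldsAt (T : XMLTree Ele) (n : T.Node) : Annotation Ele → Prop
  | .yes => True
  | .no => False
  | .cond Q => Q.toExt.Sat T n

theorem validAt_iff_holdsAt {n : T.Node} :
    S.ValidAt T n ↔ ∃ v, S.Concerned T n v ∧ v.HoldsAt T n := by
  constructor
  · rintro (h | ⟨Q, h, hQ⟩)
    · exact ⟨_, h, trivial⟩
    · exact ⟨_, h, hQ⟩
  · rintro ⟨v, h, hv⟩
    cases v with
    | yes => exact Or.inl h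
    | no => exact hv.elim
    | cond Q => exact Or.inr ⟨Q, h, hv⟩

section Fintype

variable [Fintype Ele]

theorem mem_annList {A B : Ele} {v : Annotation Ele} :
    (A, B, v) ∈ S.annList ↔ S.ann A B = some v := by
  unfold annList
  simp

theorem concerned_iff_mem_annList (hT : T.Conforms S.dtd) {n : T.Node} {v : Annotation Ele} :
    S.Concerned T n v ↔ (T.label n = .elem S.dtd.root ∧ v = .yes) ∨
      ∃ x ∈ S.annList, x.2.2 = v ∧
        ∃ m, T.child m n ∧ T.label m = .elem x.1 ∧ T.label n = .elem x.2.1 := by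
  unfold Concerned
  rw [hT.root_iff]
  refine or_congr Iff.rfl ?_
  constructor
  · rintro ⟨m, A, B, hm, hA, hB, hv⟩
    exact ⟨(A, B, v), mem_annList.2 hv, rfl, m, hm, hA, hB⟩
  · rintro ⟨⟨A, B, v⟩, hx, rfl, m, hm, hA, hB⟩
    exact ⟨m, A, B, hm, hA, hB, mem_annList.1 hx⟩

theorem annotatedQual_sat (hT : T.Conforms S.dtd) {n : T.Node} :
    S.annotatedQual.Sat T n ↔ ∃ v, S.Concerned T n v := by
  have key : ∀ L : List (Ele × Ele × Annotation Ele), (L.foldr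
      (fun x q => EQual.or (.path (.seq (.step .self (.name x.2.1)) (.step .parent (.name x.1)))) q)
      (.path (.step .self (.name S.dtd.root)))).Sat T n ↔ T.label n = .elem S.dtd.root ∨
        ∃ x ∈ L, ∃ m, T.child m n ∧ T.label m = .elem x.1 ∧ T.label n = .elem x.2.1 := by
    intro L
    induction L with
    | nil => simp [sat_self_name]
    | cons x L ih =>
      rw [List.foldr_cons, EQual.Sat, ih, sat_self_parent, List.exists_mem_cons_iff]
      exact or_left_comm
  unfold annotatedQual
  rw [key]
  simp only [concerned_iff_mem_annList hT]
  constructor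
  · rintro (h | ⟨x, hx, h⟩)
    · exact ⟨.yes, Or.inl ⟨h, rfl⟩⟩
    · exact ⟨x.2.2, Or.inr ⟨x, hx, rfl, h⟩⟩
  · rintro ⟨v, ⟨h, -⟩ | ⟨x, hx, -, h⟩⟩
    · exact Or.inl h
    · exact Or.inr ⟨x, hx, h⟩

theorem validQual_sat (hT : T.Conforms S.dtd) {n : T.Node} :
    S.validQual.Sat T n ↔ S.ValidAt T n := by
  have key : ∀ L : List (Ele × Ele × Annotation Ele), (L.foldr
      (fun (x : Ele × Ele × Annotation Ele) (q : EQual Ele) =>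
        match x with
        | (A', A, .yes) =>
          EQual.or (.path (.seq (.step .self (.name A)) (.step .parent (.name A')))) q
        | (A', A, .cond Q) =>
          .or (.path (.seq (.filter (.step .self (.name A)) Q.toExt) (.step .parent (.name A')))) q
        | (_, _, .no) => q)
      (.path (.step .self (.name S.dtd.root)))).Sat T n ↔ T.label n = .elem S.dtd.root ∨
        ∃ x ∈ L, (∃ m, T.child m n ∧ T.label m = .elem x.1 ∧ T.label n = .elem x.2.1) ∧
          x.2.2.HoldsAt T n := by
    intro L
    induction L with
    | nil => simp [sat_self_name]
    | cons x L ih =>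
      rw [List.foldr_cons, List.exists_mem_cons_iff, or_left_comm, ← ih]
      obtain ⟨A', A, v⟩ := x
      cases v with
      | yes => simp only [EQual.Sat.eq_5, sat_self_parent, Annotation.HoldsAt, and_true]
      | no => simp only [Annotation.HoldsAt, and_false, false_or]
      | cond Q => simp only [EQual.Sat.eq_5, sat_self_cond_parent, Annotation.HoldsAt]
  refine (key S.annList).trans ?_
  rw [validAt_iff_holdsAt]
  simp only [concerned_iff_mem_annList hT]
  constructor
  · rintro (h | ⟨x, hx, h, hv⟩)
    · exact ⟨.yes, Or.inl ⟨h, rfl⟩, trivial⟩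
    · exact ⟨x.2.2, Or.inr ⟨x, hx, rfl, h⟩, hv⟩
  · rintro ⟨v, ⟨h, -⟩ | ⟨x, hx, rfl, h⟩, hv⟩
    · exact Or.inl h
    · exact Or.inr ⟨x, hx, h, hv⟩

theorem acc₁_sat (hT : T.Conforms S.dtd) {n : T.Node} {A : Ele} (hA : T.label n = .elem A) :
    S.acc₁.Sat T n ↔ S.InheritsValid T n := by
  unfold acc₁
  rw [EQual.Sat]
  simp only [EPath.mem_eval_filter, EPath.mem_eval_first T (ax := .ancOrSelf) rfl,
    annotatedQual_sat hT, validQual_sat hT, Axis.Reaches, NameTest.Accepts]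
  constructor
  · rintro ⟨x, ⟨⟨rfl | hx, -, hc⟩, hmax⟩, hv⟩
    · exact Or.inl hv
    · refine Or.inr ⟨fun hn => (hmax n (Or.inl rfl) ⟨A, hA⟩ hn).not_gt (T.lt_of_anc hx),
        x, hx, hv, fun b hxb hbn hb => ?_⟩
      exact (hmax b (Or.inr hbn) (hT.exists_elem_of_anc hbn) hb).not_gt (T.lt_of_anc hxb)
  · rintro (hv | ⟨hn, a, ha, hv, hb⟩)
    · refine ⟨n, ⟨⟨Or.inl rfl, ⟨A, hA⟩, hv.concerned⟩, ?_⟩, hv⟩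
      rintro y (rfl | hy) - -
      · exact le_rfl
      · exact (T.lt_of_anc hy).le
    · refine ⟨a, ⟨⟨Or.inr ha, hT.exists_elem_of_anc ha, hv.concerned⟩, ?_⟩, hv⟩
      rintro y (rfl | hy) - hc
      · exact absurd hc hn
      · rcases T.anc_trichotomy hy ha with h | rfl | h
        · exact (T.lt_of_anc h).le
        · exact le_rfl
        · exact absurd hc (hb y h hy)

theorem acc₂_sat (hT : T.Conforms S.dtd) {n : T.Node} {A : Ele} (hA : T.label n = .elem A) :
    S.acc₂.Sat T n ↔ S.AncConds T n := by
  have key : ∀ L : List (Ele × Ele × Annotation Ele), (L.foldr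
      (fun (x : Ele × Ele × Annotation Ele) (q : EQual Ele) =>
        match x with
        | (A', A, .cond Q) =>
          EQual.and (.not (.path (.seq (.filter (.step .anc (.name A)) (.not Q.toExt))
            (.step .parent (.name A'))))) q
        | _ => q)
      (.path (.step .self .any))).Sat T n ↔ ∀ x ∈ L, ∀ Q, x.2.2 = .cond Q → ∀ a, T.anc a n →
        (∃ m, T.child m a ∧ T.label m = .elem x.1 ∧ T.label a = .elem x.2.1) →
          Q.toExt.Sat T a := by
    intro L
    induction L with
    | nil => simpa [sat_self_any] using ⟨A, hA⟩
    | cons x L ih =>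
      rw [List.foldr_cons, List.forall_mem_cons, ← ih]
      obtain ⟨A', A, v⟩ := x
      cases v with
      | yes => simp
      | no => simp
      | cond Q =>
        simp only [EQual.Sat, EPath.mem_eval_seq, EPath.mem_eval_filter, EPath.mem_eval_step,
          Axis.Reaches, NameTest.Accepts, Annotation.cond.injEq, forall_eq']
        refine and_congr ?_ Iff.rfl
        constructor
        · rintro h a ha ⟨m, hm, hA', hA⟩
          by_contra hQ
          exact h ⟨m, a, ⟨⟨ha, hA⟩, hQ⟩, hm, hA'⟩
        · rintro h ⟨m, a, ⟨⟨ha, hA⟩, hQ⟩, hm, hA'⟩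
          exact hQ (h a ha ⟨m, hm, hA', hA⟩)
  refine (key S.annList).trans ?_
  constructor
  · rintro h a Q ha hc
    rcases (concerned_iff_mem_annList hT).1 hc with ⟨-, h'⟩ | ⟨x, hx, hv, h'⟩
    · cases h'
    · exact h x hx Q hv a ha h'
  · rintro h x hx Q hv a ha h'
    exact h a Q ha ((concerned_iff_mem_annList hT).2 (Or.inr ⟨x, hx, hv, h'⟩))

theorem acc_sat (hT : T.Conforms S.dtd) {n : T.Node} {A : Ele} (hA : T.label n = .elem A) :
    S.acc.Sat T n ↔ S.Accessible T n := by
  unfold acc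
  rw [EQual.Sat, acc₁_sat hT hA, acc₂_sat hT hA, accessible_iff_of_elem hA, elemAccessible_iff]

end Fintype

/-! ### The view of a document -/

/-- Condition (ii) holds at every ancestor of an accessible node; a text node is accessible through
its parent, so this covers text nodes too. -/
theorem Accessible.ancConds {n : T.Node} (h : S.Accessible T n)
    {a : T.Node} (ha : T.anc a n) : S.AncConds T a := by
  cases e : T.label n with
  | elem A => exact AncConds.of_anc ((accessible_iff_of_elem e).1 h).2 ha
  | text s =>
    obtain ⟨m, hm, h⟩ := (accessible_iff_of_text e).1 h
    rcases T.anc_trichotomy ha hm.1 with h' | rfl | h'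
    · exact AncConds.of_anc h.2 h'
    · exact h.2
    · exact absurd ⟨a, h', ha⟩ hm.2

/-- Above an accessible node, condition (ii) is automatic. -/
theorem Accessible.accessible_anc_iff (hT : T.Conforms S.dtd) {n : T.Node}
    (h : S.Accessible T n) {a : T.Node} (ha : T.anc a n) :
    S.Accessible T a ↔ S.InheritsValid T a := by
  obtain ⟨A, hA⟩ := hT.exists_elem_of_anc ha
  rw [accessible_iff_of_elem hA, elemAccessible_iff]
  exact and_iff_left (h.ancConds ha)

section Fintype

variable [Fintype Ele]

/-- `𝒜⁺[1]` selects the parent in the view. Only condition (i) is tested on the way up. -/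
theorem mem_eval_accPlus_first (hT : T.Conforms S.dtd) {n : T.Node} (hn : S.Accessible T n)
    {x : T.Node} :
    x ∈ (EPath.pos S.accPlus 1).eval T n ↔
      ∃ hx : S.Accessible T x, (S.view T hT).child ⟨x, hx⟩ ⟨n, hn⟩ := by
  have hacc : ∀ y, T.anc y n → (S.acc₁.Sat T y ↔ S.Accessible T y) := fun y hy => by
    obtain ⟨A, hA⟩ := hT.exists_elem_of_anc hy
    rw [acc₁_sat hT hA, hn.accessible_anc_iff hT hy]
  unfold accPlus
  rw [EPath.mem_eval_first T rfl]
  simp only [Axis.Reaches, NameTest.Accepts]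
  constructor
  · rintro ⟨⟨hx, -, hs⟩, hmax⟩
    refine ⟨(hacc x hx).1 hs, hx, ?_⟩
    rintro ⟨⟨k, hk⟩, hxk, hkn⟩
    exact (hmax k hkn (hT.exists_elem_of_anc hkn) ((hacc k hkn).2 hk)).not_gt (T.lt_of_anc hxk)
  · rintro ⟨hx, hxn, hno⟩
    have hxn : T.anc x n := hxn
    refine ⟨⟨hxn, hT.exists_elem_of_anc hxn, (hacc x hxn).2 hx⟩, fun y hy _ hs => ?_⟩
    rcases T.anc_trichotomy hy hxn with h | rfl | h
    · exact (T.lt_of_anc h).le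
    · exact le_rfl
    · exact absurd ⟨⟨y, (hacc y hy).1 hs⟩, h, hy⟩ hno

theorem accParent_sat (hT : T.Conforms S.dtd) {n : T.Node} (hn : S.Accessible T n) {B : Ele} :
    (S.accParent B).Sat T n ↔
      ∃ m, (S.view T hT).child m ⟨n, hn⟩ ∧ (S.view T hT).label m = .elem B := by
  unfold accParent
  rw [EQual.Sat]
  simp only [EPath.mem_eval_seq, mem_eval_accPlus_first hT hn, EPath.mem_eval_step, Axis.Reaches,
    NameTest.Accepts]
  constructor
  · rintro ⟨x, y, ⟨hy, h⟩, rfl, hB⟩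
    exact ⟨⟨x, hy⟩, h, hB⟩
  · rintro ⟨⟨x, hx⟩, h, hB⟩
    exact ⟨x, x, ⟨hx, h⟩, rfl, hB⟩

end Fintype

/-- Walking down from a node `k` through inaccessible nodes to an accessible node `n` follows the
derivation of the content model of the DTD view. -/
theorem exposes_of_anc (hT : T.Conforms S.dtd) {n : T.Node} {B : Ele} (hB : T.label n = .elem B)
    (hn : S.ElemAccessible T n) (k : T.Node) : ∀ (A : Ele) (access : Bool), T.anc k n →
      T.label k = .elem A → (access = true ↔ S.InheritsValid T k) →
      (∀ j, T.anc k j → T.anc j n → ¬ S.InheritsValid T j) → S.Exposes A access B := by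
  -- Induction from `n` upwards; `access` records whether `k` passes on a valid annotation.
  induction k using (wellFounded_gt (α := T.Node)).induction with
  | _ k ih =>
  intro A access hk hA hacc hbetween
  obtain ⟨j, hj, hjn⟩ := T.exists_child_toward hk
  rcases hjn with rfl | hjn
  · cases hann : S.ann A B with
    | none =>
      have hc : ¬ ∃ v, S.Concerned T j v := by
        simp only [concerned_iff_of_child hj hA hB, hann]
        simp
      obtain rfl := hacc.2 ((inheritsValid_iff_of_child hj hc).1 hn.1)
      exact .inherit (hT.occurs_of_child hj hA hB) hann
    | some v =>
      cases v with
      | yes => exact .yes hann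
      | cond Q => exact .cond hann
      | no =>
        have hc : S.Concerned T j .no := (concerned_iff_of_child hj hA hB).2 hann
        rcases (inheritsValid_iff_validAt ⟨_, hc⟩).1 hn.1 with h | ⟨Q, h, -⟩
        · cases hc.unique h
        · cases hc.unique h
  · obtain ⟨E, hE⟩ := hT.exists_elem_of_anc hjn
    have hjv := hbetween j hj.1 hjn
    have hrec : S.Exposes E false B := ih j (T.lt_of_anc hj.1) E false hjn hE
      (by simpa using hjv) fun i hji => hbetween i (T.anc_trans hj.1 hji)
    cases hann : S.ann A E with
    | none =>
      have hc : ¬ ∃ v, S.Concerned T j v := by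
        simp only [concerned_iff_of_child hj hA hE, hann]
        simp
      rw [inheritsValid_iff_of_child hj hc] at hjv
      obtain rfl : access = false := by
        rw [← Bool.not_eq_true, hacc]
        exact hjv
      exact .hiddenInherit (hT.occurs_of_child hj hA hE) hann hrec
    | some v =>
      have hc : S.Concerned T j v := (concerned_iff_of_child hj hA hE).2 hann
      cases v with
      | yes => exact absurd (Or.inl (Or.inl hc)) hjv
      | cond Q => exact absurd (Or.inl (Or.inr ⟨Q, hc, hn.2 j Q hjn hc⟩)) hjv
      | no => exact .hiddenNo hann hrec

variable (hT : T.Conforms S.dtd)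

theorem viewChild_of_child {m n : (S.view T hT).Node} {A B : Ele} (h : (S.view T hT).child m n)
    (hA : T.label m.1 = .elem A) (hB : T.label n.1 = .elem B) : S.ViewChild A B := by
  have hmn : T.anc m.1 n.1 := h.1
  refine exposes_of_anc hT hB ((accessible_iff_of_elem hB).1 n.2) m.1 A true hmn hA
    (iff_of_true rfl ((accessible_iff_of_elem hA).1 m.2).1) fun j hmj hjn hj => ?_
  exact h.2 ⟨⟨j, (n.2.accessible_anc_iff hT hjn).2 hj⟩, hmj, hjn⟩

theorem viewDesc_of_anc (m : (S.view T hT).Node) {A : Ele} (hA : T.label m.1 = .elem A)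
    (n : (S.view T hT).Node) : ∀ {B : Ele}, (S.view T hT).anc m n → T.label n.1 = .elem B →
      Relation.TransGen S.ViewChild A B := by
  induction n using (wellFounded_lt (α := (S.view T hT).Node)).induction with
  | _ n ih =>
  intro B h hB
  obtain ⟨k, hk⟩ := (S.view T hT).exists_parent (n := n)
    (fun e => (S.view T hT).not_anc_root m (e ▸ h))
  obtain ⟨E, hE⟩ := hT.exists_elem_of_anc (show T.anc k.1 n.1 from hk.1)
  have hstep := viewChild_of_child hT hk hE hB
  rcases (S.view T hT).anc_trichotomy h hk.1 with h' | rfl | h'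
  · exact (ih k ((S.view T hT).lt_of_anc hk.1) h' hE).tail hstep
  · rw [hA] at hE
    cases hE
    exact .single hstep
  · exact absurd ⟨m, h', h⟩ hk.2

theorem reach_of_reaches {ax : DownAxis} {m n : (S.view T hT).Node} {A B : Ele}
    (h : ax.toAxis.Reaches (S.view T hT) m n)
    (hA : T.label m.1 = .elem A) (hB : T.label n.1 = .elem B) : S.Reach ax A B := by
  cases ax with
  | child => exact viewChild_of_child hT h hA hB
  | desc => exact viewDesc_of_anc hT m hA n h hB

theorem mem_viewTypes_of_accessible [Fintype Ele] (n : (S.view T hT).Node) {B : Ele}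
    (hB : T.label n.1 = .elem B) : B ∈ S.viewTypes := by
  have hroot := (hT.root_iff T.root).2 rfl
  unfold viewTypes
  simp only [Finset.mem_filter, Finset.mem_univ, true_and]
  by_cases e : n = (S.view T hT).root
  · subst e
    have : T.label T.root = .elem B := hB
    rw [hroot] at this
    cases this
    exact .refl
  · exact (viewDesc_of_anc hT (S.view T hT).root hroot n
      ((S.view T hT).root_anc n e) hB).to_reflTransGen

/-- The text children of an accessible element are the same in the document and in the view. -/
theorem textContent_view (m : (S.view T hT).Node) {A : Ele} (hA : T.label m.1 = .elem A) :
    (S.view T hT).textContent m = T.textContent m.1 := by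
  have hmem : ∀ x : T.Node, ((T.label x).textValue.isSome) = true →
      ((∃ hx : S.Accessible T x, (S.view T hT).child m ⟨x, hx⟩) ↔ T.child m.1 x) := by
    intro x hx
    cases e : T.label x with
    | elem B => simp [e, NodeLabel.textValue] at hx
    | text s =>
      constructor
      · rintro ⟨hx, h⟩
        have hmx : T.anc m.1 x := h.1
        obtain ⟨y, hy, hya⟩ := (accessible_iff_of_text e).1 hx
        obtain ⟨E, hE⟩ := hT.exists_elem_of_anc hy.1
        rcases T.anc_trichotomy hmx hy.1 with h' | h' | h'
        · exact absurd ⟨⟨y, (accessible_iff_of_elem hE).2 hya⟩, h', hy.1⟩ h.2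
        · exact h' ▸ hy
        · exact absurd ⟨m.1, h', hmx⟩ hy.2
      · intro h
        exact ⟨(accessible_iff_of_text e).2 ⟨m.1, h, (accessible_iff_of_elem hA).1 m.2⟩, h.1,
          fun ⟨k, hmk, hkx⟩ => h.2 ⟨k.1, hmk, hkx⟩⟩
  have hlist : (((S.view T hT).children m).map fun x : (S.view T hT).Node => x.1).filter
      (fun x => (T.label x).textValue.isSome) =
      (T.children m.1).filter fun x => (T.label x).textValue.isSome := by
    refine List.Pairwise.eq_of_mem_iff (r := (· < ·)) ?_ ((T.pairwise_listing _).filter _) ?_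
    · refine (List.pairwise_map.2 ?_).filter _
      exact (S.view T hT).pairwise_listing _
    · intro x
      simp only [List.mem_filter, List.mem_map, XMLTree.children, XMLTree.mem_listing]
      refine and_congr_left fun hx => ?_
      rw [← hmem x hx]
      constructor
      · rintro ⟨y, hy, rfl⟩
        exact ⟨y.2, hy⟩
      · rintro ⟨hx, h⟩
        exact ⟨⟨x, hx⟩, h, rfl⟩
  unfold XMLTree.textContent
  refine congrArg String.join ?_
  have hf : ∀ l : List T.Node, l.filterMap (fun x => (T.label x).textValue) =
      (l.filter fun x => (T.label x).textValue.isSome).filterMap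
        fun x => (T.label x).textValue := by
    intro l
    rw [List.filterMap_filter]
    refine List.filterMap_congr fun x _ => ?_
    cases (T.label x).textValue <;> rfl
  rw [hf (T.children m.1), ← hlist, ← hf,
    List.filterMap_map (f := fun x : (S.view T hT).Node => x.1)]
  rfl

end AccessSpec

/-! ### Values of the auxiliary computations -/

section

variable {Ele : Type}

@[simp] theorem Timed.val_bind {α β : Type} (x : Timed α) (f : α → Timed β) :
    (x >>= f).val = (f x.val).val := rfl

@[simp] theorem Timed.time_bind {α β : Type} (x : Timed α) (f : α → Timed β) :
    (x >>= f).time = x.time + (f x.val).time := rfl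

@[simp] theorem Timed.val_pure {α : Type} (a : α) : (pure a : Timed α).val = a := rfl

@[simp] theorem Timed.time_pure {α : Type} (a : α) : (pure a : Timed α).time = 0 := rfl

@[simp] theorem time_ticks (k : ℕ) : (ticks k).time = k := rfl

/-- The node `x` is an element node whose type is in the list `L`. -/
def XMLTree.TypeIn (T : XMLTree Ele) (L : List Ele) (x : T.Node) : Prop :=
  ∃ A ∈ L, T.label x = .elem A

theorem mem_eval_fusion (T : XMLTree Ele) {ax : Axis} {L : List Ele} {n x : T.Node} :
    x ∈ (fusion ax L).val.eval T n ↔ ax.Reaches T n x ∧ T.TypeIn L x := by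
  induction L with
  | nil =>
    simp only [fusion, Timed.val_bind, Timed.val_pure, XMLTree.TypeIn]
    simp [mem_eval_emptyPath]
  | cons E L ih =>
    have hcons : T.TypeIn (E :: L) x ↔ T.label x = .elem E ∨ T.TypeIn L x := by
      simp [XMLTree.TypeIn]
    rw [hcons]
    cases L with
    | nil =>
      simp only [fusion, Timed.val_bind, Timed.val_pure, XMLTree.TypeIn]
      simp [EPath.mem_eval_step, NameTest.Accepts]
    | cons F L =>
      rw [fusion]
      · simp only [Timed.val_bind, Timed.val_pure, EPath.mem_eval_union, ih, EPath.mem_eval_step,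
          NameTest.Accepts]
        exact and_or_left.symm
      · simp

theorem mem_eval_applyFilters (T : XMLTree Ele) {qs : List (EQual Ele)} {p : EPath Ele}
    {n x : T.Node} : x ∈ (applyFilters p qs).val.eval T n ↔
      x ∈ p.eval T n ∧ ∀ q ∈ qs, q.Sat T x := by
  induction qs generalizing p with
  | nil => simp [applyFilters]
  | cons q qs ih =>
    simp only [applyFilters, Timed.val_bind, ih, EPath.mem_eval_filter, List.forall_mem_cons,
      and_assoc]

theorem someReach_val {tab : Tables Ele} {ax : DownAxis} {B : Ele} {L : List Ele} :
    (someReach tab ax B L).val = true ↔ ∃ A ∈ L, tab.reach ax A B = true := by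
  induction L with
  | nil => simp [someReach]
  | cons E L ih =>
    simp only [someReach, Timed.val_bind, List.exists_mem_cons_iff]
    split_ifs with h <;> simp [h, ih]

theorem starReach_val {tab : Tables Ele} {ax : DownAxis} {L Bs : List Ele} :
    (starReach tab ax L Bs).val = Bs.filter fun B => (someReach tab ax B L).val := by
  induction Bs with
  | nil => rfl
  | cons B Bs ih => simp only [starReach, Timed.val_bind, Timed.val_pure, ih, List.filter_cons]

theorem memList_val [DecidableEq Ele] {x : Ele} {L : List Ele} :
    (memList x L).val = decide (x ∈ L) := by
  induction L with
  | nil => simp [memList]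
  | cons y L ih =>
    simp only [memList, Timed.val_bind]
    split_ifs with h <;> simp [h, ih]

theorem mem_unionList [DecidableEq Ele] {x : Ele} {L M : List Ele} :
    x ∈ (unionList L M).val ↔ x ∈ L ∨ x ∈ M := by
  induction L with
  | nil => simp [unionList]
  | cons y L ih =>
    simp only [unionList, Timed.val_bind, Timed.val_pure, memList_val, decide_eq_true_eq]
    split_ifs with h
    · rw [ih, List.mem_cons]
      constructor
      · tauto
      · rintro ((rfl | h') | h') <;> tauto
    · rw [List.mem_cons, ih, List.mem_cons, or_assoc]

/-- The node comparison with `ε::*` at an element node asks for the way back to that node. -/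
theorem sat_eqNode_any (T : XMLTree Ele) {p : EPath Ele} {n : T.Node} {A : Ele}
    (hA : T.label n = .elem A) : (EQual.eqNode p .any).Sat T n ↔ n ∈ p.eval T n := by
  rw [EQual.Sat]
  simp only [XMLTree.mem_stepNodes, Axis.Reaches, NameTest.Accepts]
  constructor
  · rintro ⟨m, h, rfl, -⟩
    exact h
  · exact fun h => ⟨n, h, rfl, A, hA⟩

end

/-! ### Soundness of the rewriting -/

namespace AccessSpec

variable {Ele : Type} {S : AccessSpec Ele} {T : XMLTree Ele} (hT : T.Conforms S.dtd)

/-- A trail describes a relation `P` between context nodes and selected nodes of the view: from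
context nodes with types in `L`, the selected nodes are those of a reached type that pass the
filters and lead back, in the document, to the context node. The way back ends at accessible nodes
with types in `L` only, so that it can be continued; for a single `↓⁺` step it ends at every
ancestor of that kind. -/
structure TrailSound (P : (S.view T hT).Node → (S.view T hT).Node → Prop) (L : List Ele)
    (t : Trail Ele) : Prop where
  iff_back : ∀ n m, T.TypeIn L n.1 → (P n m ↔ T.TypeIn t.reach m.1 ∧
    (∀ q ∈ t.filters, q.Sat T m.1) ∧ n.1 ∈ t.back.eval T m.1)
  back_mem : ∀ m : (S.view T hT).Node, T.TypeIn t.reach m.1 → ∀ x ∈ t.back.eval T m.1,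
    S.Accessible T x ∧ T.TypeIn L x
  anc_of : ∀ n m, T.TypeIn L n.1 → P n m → (S.view T hT).anc n m
  single_back : t.single = true → ∀ n m : (S.view T hT).Node, T.TypeIn L n.1 →
    T.TypeIn t.reach m.1 → (S.view T hT).anc n m → n.1 ∈ t.back.eval T m.1

/-- The outcome of processing a path describes `P`; a rejected path selects nothing. -/
def OutcomeSound (P : (S.view T hT).Node → (S.view T hT).Node → Prop) (L : List Ele) :
    Option (Trail Ele) → Prop
  | none => ∀ n m, T.TypeIn L n.1 → ¬ P n m
  | some t => TrailSound hT P L t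

/-- The truth value of a rewritten predicate. -/
def _root_.SecureXML.Verdict.Holds (T : XMLTree Ele) (n : T.Node) : Verdict Ele → Prop
  | .ff => False
  | .tt => True
  | .qual q => q.Sat T n

/-- The verdict, evaluated in the document, agrees with the predicate `P` on the view. -/
def VerdictSound (P : (S.view T hT).Node → Prop) (L : List Ele) (v : Verdict Ele) : Prop :=
  ∀ n, T.TypeIn L n.1 → (v.Holds T n.1 ↔ P n)

variable {hT} {P Q : (S.view T hT).Node → (S.view T hT).Node → Prop}
  {L : List Ele}

theorem VerdictSound.congr {p q : (S.view T hT).Node → Prop} {v : Verdict Ele}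
    (h : VerdictSound hT p L v) (e : ∀ n, p n ↔ q n) : VerdictSound hT q L v := by
  obtain rfl : p = q := funext fun n => propext (e n)
  exact h

theorem outcomeSound_addFilter {t : Trail Ele} (ht : TrailSound hT P L t)
    {p : (S.view T hT).Node → Prop} {v : Verdict Ele} (hv : VerdictSound hT p t.reach v) :
    OutcomeSound hT (fun n m => P n m ∧ p m) L (addFilter t v) := by
  have key : ∀ n m, T.TypeIn L n.1 → P n m → (v.Holds T m.1 ↔ p m) := fun n m hn hm =>
    hv m ((ht.iff_back n m hn).1 hm).1
  cases v with
  | ff => exact fun n m hn h => (key n m hn h.1).2 h.2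
  | tt =>
    exact ⟨fun n m hn => by
      rw [← ht.iff_back n m hn]
      exact and_iff_left_of_imp fun h => (key n m hn h).1 trivial,
      ht.back_mem, fun n m hn h => ht.anc_of n m hn h.1, ht.single_back⟩
  | qual q =>
    refine ⟨fun n m hn => ?_, ht.back_mem, fun n m hn h => ht.anc_of n m hn h.1, ht.single_back⟩
    have h1 := key n m hn
    have h2 := ht.iff_back n m hn
    simp only [Verdict.Holds] at h1
    simp only [List.forall_mem_cons]
    tauto

theorem trailSound_seqTrail {t₁ t₂ : Trail Ele} (h₁ : TrailSound hT P L t₁)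
    (h₂ : TrailSound hT Q t₁.reach t₂) :
    TrailSound hT (fun n m => ∃ k, P n k ∧ Q k m) L (seqTrail t₁ t₂).val := by
  have hback : ∀ {m x : T.Node}, x ∈ (seqTrail t₁ t₂).val.back.eval T m ↔
      ∃ k, (k ∈ t₂.back.eval T m ∧ ∀ q ∈ t₁.filters, q.Sat T k) ∧ x ∈ t₁.back.eval T k := by
    intro m x
    simp only [seqTrail, Timed.val_bind, Timed.val_pure, EPath.mem_eval_seq,
      mem_eval_applyFilters]
  refine ⟨fun n m hn => ?_, fun m hm x hx => ?_, ?_, fun h => ?_⟩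
  · rw [hback]
    constructor
    · rintro ⟨k, hP, hQ⟩
      obtain ⟨hk, hf, hb⟩ := (h₁.iff_back n k hn).1 hP
      obtain ⟨hm, hf', hb'⟩ := (h₂.iff_back k m hk).1 hQ
      exact ⟨hm, hf', k.1, ⟨hb', hf⟩, hb⟩
    · rintro ⟨hm, hf', k, ⟨hb', hf⟩, hb⟩
      obtain ⟨hka, hk⟩ := h₂.back_mem m hm k hb'
      exact ⟨⟨k, hka⟩, (h₁.iff_back n ⟨k, hka⟩ hn).2 ⟨hk, hf, hb⟩,
        (h₂.iff_back ⟨k, hka⟩ m hk).2 ⟨hm, hf', hb'⟩⟩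
  · obtain ⟨k, ⟨hk, -⟩, hx⟩ := hback.1 hx
    obtain ⟨hka, hkt⟩ := h₂.back_mem m hm k hk
    exact h₁.back_mem ⟨k, hka⟩ hkt x hx
  · rintro n m hn ⟨k, hP, hQ⟩
    exact (S.view T hT).anc_trans (h₁.anc_of n k hn hP)
      (h₂.anc_of k m ((h₁.iff_back n k hn).1 hP).1 hQ)
  · cases h

theorem mem_eval_branch {t : Trail Ele} {m x : T.Node} :
    x ∈ (branch t).val.eval T m ↔
      T.TypeIn t.reach m ∧ (∀ q ∈ t.filters, q.Sat T m) ∧ x ∈ t.back.eval T m := by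
  simp only [branch, Timed.val_bind, Timed.val_pure, EPath.mem_eval_seq, mem_eval_applyFilters,
    mem_eval_fusion, Axis.Reaches]
  constructor
  · rintro ⟨k, ⟨⟨rfl, h1⟩, h2⟩, h3⟩
    exact ⟨h1, h2, h3⟩
  · rintro ⟨h1, h2, h3⟩
    exact ⟨m, ⟨⟨rfl, h1⟩, h2⟩, h3⟩

theorem outcomeSound_unionTrail [DecidableEq Ele] {o₁ o₂ : Option (Trail Ele)}
    (h₁ : OutcomeSound hT P L o₁) (h₂ : OutcomeSound hT Q L o₂) :
    OutcomeSound hT (fun n m => P n m ∨ Q n m) L (unionTrail o₁ o₂).val := by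
  rcases o₁ with _ | t₁
  · have e : ∀ n m, T.TypeIn L n.1 → (P n m ∨ Q n m ↔ Q n m) := fun n m hn =>
      or_iff_right (h₁ n m hn)
    rcases o₂ with _ | t₂
    · exact fun n m hn h => h₂ n m hn ((e n m hn).1 h)
    · exact ⟨fun n m hn => (e n m hn).trans (h₂.iff_back n m hn), h₂.back_mem,
        fun n m hn h => h₂.anc_of n m hn ((e n m hn).1 h), h₂.single_back⟩
  · rcases o₂ with _ | t₂
    · have e : ∀ n m, T.TypeIn L n.1 → (P n m ∨ Q n m ↔ P n m) := fun n m hn =>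
        or_iff_left (h₂ n m hn)
      exact ⟨fun n m hn => (e n m hn).trans (h₁.iff_back n m hn), h₁.back_mem,
        fun n m hn h => h₁.anc_of n m hn ((e n m hn).1 h), h₁.single_back⟩
    · simp only [unionTrail, Timed.val_bind, Timed.val_pure]
      refine ⟨fun n m hn => ?_, fun m _ x hx => ?_, fun n m hn h => ?_, fun h => ?_⟩
      · simp only [EPath.mem_eval_union, mem_eval_branch, List.not_mem_nil, false_implies,
          implies_true, true_and]
        rw [← h₁.iff_back n m hn, ← h₂.iff_back n m hn]
        refine (and_iff_right_of_imp fun h => ?_).symm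
        rcases h with h | h
        · obtain ⟨A, hA, hm⟩ := ((h₁.iff_back n m hn).1 h).1
          exact ⟨A, mem_unionList.2 (Or.inl hA), hm⟩
        · obtain ⟨A, hA, hm⟩ := ((h₂.iff_back n m hn).1 h).1
          exact ⟨A, mem_unionList.2 (Or.inr hA), hm⟩
      · simp only [EPath.mem_eval_union, mem_eval_branch] at hx
        rcases hx with ⟨h, -, hx⟩ | ⟨h, -, hx⟩
        · exact h₁.back_mem m h x hx
        · exact h₂.back_mem m h x hx
      · exact h.elim (h₁.anc_of n m hn) (h₂.anc_of n m hn)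
      · cases h

/-- The optional comparison of the text content of a node with a string. -/
def _root_.SecureXML.XMLTree.TextIs (T : XMLTree Ele) (n : T.Node) : Option String → Prop
  | none => True
  | some c => T.textContent n = c

theorem sat_textTest {c : Option String} {m : (S.view T hT).Node} {A : Ele}
    (hA : T.label m.1 = .elem A) :
    (∀ q ∈ (textTest c : Timed (List (EQual Ele))).val, q.Sat T m.1) ↔
      (S.view T hT).TextIs m c := by
  cases c with
  | none => simp [textTest, XMLTree.TextIs]
  | some c =>
    simp only [textTest, Timed.val_bind, Timed.val_pure, List.mem_singleton, forall_eq,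
      EQual.Sat, EPath.mem_eval_step, Axis.Reaches, NameTest.Accepts, XMLTree.TextIs,
      textContent_view hT m hA]
    constructor
    · rintro ⟨x, ⟨rfl, -⟩, h⟩
      exact h
    · exact fun h => ⟨m.1, ⟨rfl, A, hA⟩, h⟩

section Fintype

variable [Fintype Ele]

theorem tables_reach {ax : DownAxis} {A B : Ele} :
    S.tables.reach ax A B = true ↔ S.Reach ax A B := by
  simp [tables]

/-- The types computed for a step are those that a node of the view can have after the step. -/
theorem typeIn_stepReach {ax : DownAxis} {l : NameTest Ele} {n m : (S.view T hT).Node}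
    (hn : T.TypeIn L n.1) (h : ax.toAxis.Reaches (S.view T hT) n m) :
    T.TypeIn (stepReach S.tables ax L l).val m.1 ↔ l.Accepts (T.label m.1) := by
  have hsome : ∀ B, T.label m.1 = .elem B → (someReach S.tables ax B L).val = true := by
    intro B hB
    obtain ⟨A, hA, hnA⟩ := hn
    exact someReach_val.2 ⟨A, hA, tables_reach.2 (reach_of_reaches hT h hnA hB)⟩
  cases l with
  | any =>
    simp only [stepReach, starReach_val, NameTest.Accepts]
    constructor
    · rintro ⟨A, -, hA⟩
      exact ⟨A, hA⟩
    · rintro ⟨A, hA⟩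
      refine ⟨A, List.mem_filter.2 ⟨?_, hsome A hA⟩, hA⟩
      exact Finset.mem_toList.2 (mem_viewTypes_of_accessible hT m hA)
  | name E =>
    simp only [stepReach, Timed.val_bind, Timed.val_pure, NameTest.Accepts]
    constructor
    · rintro ⟨A, hA, hm⟩
      split_ifs at hA with hb
      · rw [List.mem_singleton.1 hA] at hm
        exact hm
      · cases hA
    · intro hm
      rw [if_pos (hsome E hm)]
      exact ⟨E, List.mem_singleton.2 rfl, hm⟩

theorem stepTrail_val {ax : DownAxis} {l : NameTest Ele} :
    (stepTrail S.tables ax l L).val =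
      if (stepReach S.tables ax L l).val.isEmpty then none
      else match ax with
        | .child => some ⟨(stepReach S.tables ax L l).val, [],
            .seq (.pos S.accPlus 1) (fusion .self L).val, false⟩
        | .desc => some ⟨(stepReach S.tables ax L l).val, [],
            .filter (fusion .anc L).val S.acc, true⟩ := by
  simp only [stepTrail, Timed.val_bind]
  split_ifs
  · rfl
  · cases ax <;> rfl

theorem outcomeSound_stepTrail (ax : DownAxis) (l : NameTest Ele) :
    OutcomeSound hT
      (fun n m => m ∈ (EPath.step ax.toAxis l).eval (S.view T hT) n) L
      (stepTrail S.tables ax l L).val := by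
  have hreach : ∀ {n m : (S.view T hT).Node}, T.TypeIn L n.1 →
      (m ∈ (EPath.step ax.toAxis l).eval (S.view T hT) n ↔
        ax.toAxis.Reaches (S.view T hT) n m ∧
          T.TypeIn (stepReach S.tables ax L l).val m.1) := fun {n m} hn => by
    rw [EPath.mem_eval_step]
    exact and_congr_right fun h => (typeIn_stepReach hn h).symm
  rw [stepTrail_val]
  split_ifs with hempty
  · intro n m hn h
    obtain ⟨A, hA, -⟩ := ((hreach hn).1 h).2
    rw [List.isEmpty_iff.1 hempty] at hA
    cases hA
  · cases ax with
    | child =>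
      have hback : ∀ {m : (S.view T hT).Node} {x : T.Node},
          x ∈ (EPath.seq (.pos S.accPlus 1) (fusion .self L).val).eval T m.1 ↔
            ∃ hx : S.Accessible T x, (S.view T hT).child ⟨x, hx⟩ m ∧ T.TypeIn L x := by
        intro m x
        simp only [EPath.mem_eval_seq, mem_eval_accPlus_first hT m.2, mem_eval_fusion,
          Axis.Reaches]
        constructor
        · rintro ⟨k, ⟨hx, h⟩, rfl, hL⟩
          exact ⟨hx, h, hL⟩
        · rintro ⟨hx, h, hL⟩
          exact ⟨x, ⟨hx, h⟩, rfl, hL⟩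
      refine ⟨fun n m hn => ?_, fun m _ x hx => ?_, fun n m hn h => ?_, fun h => ?_⟩
      · rw [hreach hn, hback]
        constructor
        · rintro ⟨h, hm⟩
          exact ⟨hm, by simp, n.2, h, hn⟩
        · rintro ⟨hm, -, _, h, -⟩
          exact ⟨h, hm⟩
      · obtain ⟨hx, -, hL⟩ := hback.1 hx
        exact ⟨hx, hL⟩
      · exact ((hreach hn).1 h).1.1
      · cases h
    | desc =>
      have hback : ∀ {m x : T.Node},
          x ∈ (EPath.filter (fusion .anc L).val S.acc).eval T m ↔
            T.anc x m ∧ T.TypeIn L x ∧ S.Accessible T x := by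
        intro m x
        simp only [EPath.mem_eval_filter, mem_eval_fusion, Axis.Reaches, and_assoc]
        refine and_congr_right fun _ => and_congr_right fun ⟨A, _, hA⟩ => acc_sat hT hA
      refine ⟨fun n m hn => ?_, fun m _ x hx => ?_, fun n m hn h => ?_, fun _ n m hn _ h => ?_⟩
      · rw [hreach hn, hback]
        constructor
        · rintro ⟨h, hm⟩
          exact ⟨hm, by simp, h, hn, n.2⟩
        · rintro ⟨hm, -, h, -⟩
          exact ⟨h, hm⟩
      · exact ⟨(hback.1 hx).2.2, (hback.1 hx).2.1⟩
      · exact ((hreach hn).1 h).1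
      · exact hback.2 ⟨h, hn, n.2⟩

/-- The candidates of a rewritten predicate or query: accessible descendants of the context node
with a reached type, that pass all filters. -/
theorem mem_eval_candidates {L : List Ele} {fs : List (EQual Ele)} {n x : T.Node}
    (hT : T.Conforms S.dtd) :
    x ∈ (applyFilters (.filter (fusion .desc L).val S.acc) fs).val.eval T n ↔
      T.anc n x ∧ T.TypeIn L x ∧ S.Accessible T x ∧ ∀ q ∈ fs, q.Sat T x := by
  simp only [mem_eval_applyFilters, EPath.mem_eval_filter, mem_eval_fusion, Axis.Reaches,
    and_assoc]
  refine and_congr_right fun _ => and_congr_right fun ⟨A, _, hA⟩ => ?_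
  rw [acc_sat hT hA]

theorem verdictSound_closePred {t : Trail Ele} (ht : TrailSound hT P L t)
    (extra : List (EQual Ele)) :
    VerdictSound hT (fun n => ∃ m, P n m ∧ ∀ q ∈ extra, q.Sat T m.1) L
      (closePred S.tables t extra).val := by
  intro n hn
  obtain ⟨A, -, hA⟩ := id hn
  have hcand : ∀ x, x ∈ (applyFilters (applyFilters
      (.filter (fusion .desc t.reach).val S.acc) t.filters).val extra).val.eval T n.1 ↔
      (T.anc n.1 x ∧ T.TypeIn t.reach x ∧ S.Accessible T x ∧ ∀ q ∈ t.filters, q.Sat T x) ∧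
        ∀ q ∈ extra, q.Sat T x := fun x => by
    rw [mem_eval_applyFilters, mem_eval_candidates hT]
  simp only [closePred, Timed.val_bind, show S.tables.acc = S.acc from rfl]
  split_ifs with hs
  · simp only [Timed.val_bind, Timed.val_pure, Verdict.Holds, EQual.Sat, hcand]
    constructor
    · rintro ⟨m, ⟨hnm, hm, hma, hf⟩, he⟩
      exact ⟨⟨m, hma⟩, (ht.iff_back n ⟨m, hma⟩ hn).2
        ⟨hm, hf, ht.single_back hs n ⟨m, hma⟩ hn hm hnm⟩, he⟩
    · rintro ⟨m, hP, he⟩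
      obtain ⟨hm, hf, -⟩ := (ht.iff_back n m hn).1 hP
      exact ⟨m.1, ⟨ht.anc_of n m hn hP, hm, m.2, hf⟩, he⟩
  · simp only [Timed.val_bind, Timed.val_pure, Verdict.Holds, sat_eqNode_any T hA,
      EPath.mem_eval_seq, hcand]
    constructor
    · rintro ⟨m, ⟨⟨-, hm, hma, hf⟩, he⟩, hb⟩
      exact ⟨⟨m, hma⟩, (ht.iff_back n ⟨m, hma⟩ hn).2 ⟨hm, hf, hb⟩, he⟩
    · rintro ⟨m, hP, he⟩
      obtain ⟨hm, hf, hb⟩ := (ht.iff_back n m hn).1 hP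
      exact ⟨m.1, ⟨⟨ht.anc_of n m hn hP, hm, m.2, hf⟩, he⟩, hb⟩

theorem verdictSound_closePred_textTest {t : Trail Ele} (ht : TrailSound hT P L t)
    (c : Option String) :
    VerdictSound hT (fun n => ∃ m, P n m ∧ (S.view T hT).TextIs m c) L
      (closePred S.tables t (textTest c).val).val := by
  intro n hn
  rw [verdictSound_closePred ht _ n hn]
  refine exists_congr fun m => and_congr_right fun hP => ?_
  obtain ⟨A, -, hA⟩ := ((ht.iff_back n m hn).1 hP).1
  exact sat_textTest hA

end Fintype

section Verdicts

variable {p q : (S.view T hT).Node → Prop} {v w : Verdict Ele}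

theorem verdictSound_andVerdict (hv : VerdictSound hT p L v) (hw : VerdictSound hT q L w) :
    VerdictSound hT (fun n => p n ∧ q n) L (andVerdict v w).val := by
  intro n hn
  change _ ↔ (p n ∧ q n)
  rw [← hv n hn, ← hw n hn]
  cases v <;> cases w <;> simp [andVerdict, Verdict.Holds, EQual.Sat]

theorem verdictSound_orVerdict (hv : VerdictSound hT p L v) (hw : VerdictSound hT q L w) :
    VerdictSound hT (fun n => p n ∨ q n) L (orVerdict v w).val := by
  intro n hn
  change _ ↔ (p n ∨ q n)
  rw [← hv n hn, ← hw n hn]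
  cases v <;> cases w <;> simp [orVerdict, Verdict.Holds, EQual.Sat]

theorem verdictSound_notVerdict (hv : VerdictSound hT p L v) :
    VerdictSound hT (fun n => ¬ p n) L (notVerdict v).val := by
  intro n hn
  change _ ↔ ¬ p n
  rw [← hv n hn]
  cases v <;> simp [notVerdict, Verdict.Holds, EQual.Sat]

end Verdicts

variable [Fintype Ele] [DecidableEq Ele]

variable (hT)

mutual

theorem outcomeSound_trail : ∀ (p : Path Ele) (L : List Ele),
    OutcomeSound hT (fun n m => m ∈ p.toExt.eval (S.view T hT) n) L (trail S.tables p L).val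
  | .step ax l, L => by
    simp only [trail, Path.toExt]
    exact outcomeSound_stepTrail ax l
  | .filter p q, L => by
    have hp := outcomeSound_trail p L
    simp only [trail, Path.toExt, Timed.val_bind, EPath.mem_eval_filter]
    rcases h : (trail S.tables p L).val with _ | t
    · rw [h] at hp
      exact fun n m hn h' => hp n m hn h'.1
    · rw [h] at hp
      exact outcomeSound_addFilter hp (verdictSound_rwPred q t.reach)
  | .seq p q, L => by
    have hp := outcomeSound_trail p L
    simp only [trail, Path.toExt, Timed.val_bind, EPath.mem_eval_seq]
    rcases h : (trail S.tables p L).val with _ | t₁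
    · rw [h] at hp
      exact fun n m hn ⟨k, h', _⟩ => hp n k hn h'
    · rw [h] at hp
      have hq := outcomeSound_trail q t₁.reach
      simp only [Timed.val_bind]
      rcases h' : (trail S.tables q t₁.reach).val with _ | t₂
      · rw [h'] at hq
        exact fun n m hn ⟨k, h1, h2⟩ => hq k m ((hp.iff_back n k hn).1 h1).1 h2
      · rw [h'] at hq
        exact trailSound_seqTrail hp hq
  | .union p q, L => by
    simp only [trail, Path.toExt, Timed.val_bind, EPath.mem_eval_union]
    exact outcomeSound_unionTrail (outcomeSound_trail p L) (outcomeSound_trail q L)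

theorem verdictSound_rwPath : ∀ (p : Path Ele) (c : Option String) (L : List Ele),
    VerdictSound hT (fun n => ∃ m, m ∈ p.toExt.eval (S.view T hT) n ∧ (S.view T hT).TextIs m c) L
      (rwPath S.tables p c L).val
  | .step ax l, c, L => by
    have hp := outcomeSound_stepTrail (hT := hT) (L := L) ax l
    simp only [rwPath, Path.toExt, Timed.val_bind]
    rcases h : (stepTrail S.tables ax l L).val with _ | t
    · rw [h] at hp
      exact fun n hn => iff_of_false id fun ⟨m, hm, _⟩ => hp n m hn hm
    · rw [h] at hp
      exact verdictSound_closePred_textTest hp c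
  | .filter p q, c, L => by
    have hp := outcomeSound_trail p L
    simp only [rwPath, Path.toExt, Timed.val_bind, EPath.mem_eval_filter]
    rcases h : (trail S.tables p L).val with _ | t
    · rw [h] at hp
      exact fun n hn => iff_of_false id fun ⟨m, hm, _⟩ => hp n m hn hm.1
    · rw [h] at hp
      have hq := outcomeSound_addFilter hp (verdictSound_rwPred q t.reach)
      simp only [Timed.val_bind]
      rcases h' : addFilter t (rwPred S.tables q t.reach).val with _ | t'
      · rw [h'] at hq
        exact fun n hn => iff_of_false id fun ⟨m, hm, _⟩ => hq n m hn hm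
      · rw [h'] at hq
        exact verdictSound_closePred_textTest hq c
  | .seq p q, c, L => by
    have hp := outcomeSound_trail p L
    simp only [rwPath, Path.toExt, Timed.val_bind, EPath.mem_eval_seq]
    have e : ∀ n : (S.view T hT).Node,
        (∃ k, k ∈ p.toExt.eval (S.view T hT) n ∧
          ∃ m, m ∈ q.toExt.eval (S.view T hT) k ∧ (S.view T hT).TextIs m c) ↔
        ∃ m, (∃ k, k ∈ p.toExt.eval (S.view T hT) n ∧ m ∈ q.toExt.eval (S.view T hT) k) ∧
          (S.view T hT).TextIs m c := fun n =>
      ⟨fun ⟨k, h1, m, h2, h3⟩ => ⟨m, ⟨k, h1, h2⟩, h3⟩,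
        fun ⟨m, ⟨k, h1, h2⟩, h3⟩ => ⟨k, h1, m, h2, h3⟩⟩
    refine VerdictSound.congr ?_ e
    rcases h : (trail S.tables p L).val with _ | t
    · rw [h] at hp
      exact fun n hn => iff_of_false id fun ⟨m, hm, _⟩ => hp n m hn hm
    · rw [h] at hp
      have hq := outcomeSound_addFilter hp (verdictSound_rwPath q c t.reach)
      simp only [Timed.val_bind]
      rcases h' : addFilter t (rwPath S.tables q c t.reach).val with _ | t'
      · rw [h'] at hq
        exact fun n hn => iff_of_false id fun ⟨m, hm⟩ => hq n m hn hm
      · rw [h'] at hq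
        refine (verdictSound_closePred hq []).congr fun n => ?_
        simp
  | .union p q, c, L => by
    simp only [rwPath, Path.toExt, Timed.val_bind, EPath.mem_eval_union]
    refine (verdictSound_orVerdict (verdictSound_rwPath p c L)
      (verdictSound_rwPath q c L)).congr fun n => ?_
    rw [← exists_or]
    exact exists_congr fun m => or_and_right.symm

theorem verdictSound_rwPred : ∀ (q : Qual Ele) (L : List Ele),
    VerdictSound hT (fun n => q.toExt.Sat (S.view T hT) n) L (rwPred S.tables q L).val
  | .path p, L => by
    simp only [rwPred, Qual.toExt, Timed.val_bind]
    refine (verdictSound_rwPath p none L).congr fun n => ?_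
    simp [EQual.Sat, XMLTree.TextIs]
  | .eqText p c, L => by
    simp only [rwPred, Qual.toExt, Timed.val_bind]
    refine (verdictSound_rwPath p (some c) L).congr fun n => ?_
    simp [EQual.Sat, XMLTree.TextIs]
  | .and q r, L => by
    simp only [rwPred, Qual.toExt, Timed.val_bind, EQual.Sat]
    exact verdictSound_andVerdict (verdictSound_rwPred q L) (verdictSound_rwPred r L)
  | .or q r, L => by
    simp only [rwPred, Qual.toExt, Timed.val_bind, EQual.Sat]
    exact verdictSound_orVerdict (verdictSound_rwPred q L) (verdictSound_rwPred r L)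
  | .not q, L => by
    simp only [rwPred, Qual.toExt, Timed.val_bind, EQual.Sat]
    exact verdictSound_notVerdict (verdictSound_rwPred q L)

end

theorem mem_closeQuery_trail (p : Path Ele) {x : T.Node} :
    x ∈ (closeQuery S.tables (trail S.tables p [S.dtd.root]).val).val.eval T T.root ↔
      ∃ hx : S.Accessible T x, (⟨x, hx⟩ : (S.view T hT).Node) ∈
        p.toExt.eval (S.view T hT) (S.view T hT).root := by
  have hroot : ∀ y, T.TypeIn [S.dtd.root] y ↔ y = T.root := fun y => by
    rw [← hT.root_iff]
    simp [XMLTree.TypeIn]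
  have hr := (hroot T.root).2 rfl
  have hp := outcomeSound_trail hT p [S.dtd.root]
  rcases h : (trail S.tables p [S.dtd.root]).val with _ | t
  · rw [h] at hp
    simp only [closeQuery, Timed.val_bind, Timed.val_pure]
    exact iff_of_false (mem_eval_emptyPath T) fun ⟨hx, hm⟩ => hp (S.view T hT).root _ hr hm
  · rw [h] at hp
    simp only [closeQuery, Timed.val_bind, Timed.val_pure, show S.tables.acc = S.acc from rfl]
    rw [EPath.mem_eval_filter, mem_eval_candidates hT, EQual.Sat]
    constructor
    · rintro ⟨⟨-, hx, hxa, hf⟩, y, hy⟩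
      -- The way back ends at a node of root type, which is the root itself.
      obtain rfl := (hroot y).1 (hp.back_mem ⟨x, hxa⟩ hx y hy).2
      exact ⟨hxa, (hp.iff_back (S.view T hT).root ⟨x, hxa⟩ hr).2 ⟨hx, hf, hy⟩⟩
    · rintro ⟨hxa, hm⟩
      obtain ⟨hx, hf, hb⟩ := (hp.iff_back (S.view T hT).root ⟨x, hxa⟩ hr).1 hm
      exact ⟨⟨hp.anc_of _ _ hr hm, hx, hxa, hf⟩, _, hb⟩

theorem mem_rewriteFrom (p : Path Ele) {x : T.Node} :
    x ∈ (rewriteFrom S.tables p S.dtd.root).val.eval T T.root ↔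
      ∃ hx : S.Accessible T x, (⟨x, hx⟩ : (S.view T hT).Node) ∈
        p.toExt.eval (S.view T hT) (S.view T hT).root := by
  match p with
  | .step ax l => exact mem_closeQuery_trail hT (.step ax l)
  | .filter p q => exact mem_closeQuery_trail hT (.filter p q)
  | .seq p q => exact mem_closeQuery_trail hT (.seq p q)
  | .union p q =>
    simp only [rewriteFrom, Timed.val_bind, Timed.val_pure, Path.toExt, EPath.mem_eval_union,
      mem_rewriteFrom p, mem_rewriteFrom q]
    exact exists_or.symm.trans
      (exists_congr fun hx => (EPath.mem_eval_union (S.view T hT)).symm)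

theorem image_answer_view (Q : Path Ele) :
    Subtype.val '' Q.answer (S.view T hT) = (S.rewrite Q).val.answer T := by
  ext x
  simp only [EPath.answer, Set.mem_ofPred_eq, rewrite, mem_rewriteFrom hT]
  constructor
  · rintro ⟨y, hy, rfl⟩
    exact ⟨y.2, hy⟩
  · rintro ⟨hx, h⟩
    exact ⟨⟨x, hx⟩, h, rfl⟩

end AccessSpec

/-! ### Running time -/

section

variable {Ele : Type}

theorem time_fusion_le (ax : Axis) (L : List Ele) : (fusion ax L).time ≤ 2 * L.length + 4 := by
  induction L with
  | nil => simp [fusion]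
  | cons E L ih =>
    cases L with
    | nil => simp [fusion]
    | cons F L =>
      rw [fusion]
      · simp only [Timed.time_bind, Timed.time_pure, time_ticks, List.length_cons] at ih ⊢
        omega
      · simp

theorem time_applyFilters (p : EPath Ele) (qs : List (EQual Ele)) :
    (applyFilters p qs).time = qs.length := by
  induction qs generalizing p with
  | nil => rfl
  | cons q qs ih =>
    simp only [applyFilters, Timed.time_bind, time_ticks, ih, List.length_cons]
    omega

theorem time_someReach_le (tab : Tables Ele) (ax : DownAxis) (B : Ele) (L : List Ele) :
    (someReach tab ax B L).time ≤ L.length := by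
  induction L with
  | nil => simp [someReach]
  | cons E L ih =>
    simp only [someReach, Timed.time_bind, time_ticks, List.length_cons]
    split_ifs
    · simp
    · omega

theorem time_starReach_le (tab : Tables Ele) (ax : DownAxis) (L Bs : List Ele) :
    (starReach tab ax L Bs).time ≤ Bs.length * (L.length + 1) := by
  induction Bs with
  | nil => simp [starReach]
  | cons B Bs ih =>
    have := time_someReach_le tab ax B L
    simp only [starReach, Timed.time_bind, Timed.time_pure, time_ticks, List.length_cons,
      Nat.succ_mul]
    omega

theorem time_memList_le [DecidableEq Ele] (x : Ele) (L : List Ele) :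
    (memList x L).time ≤ L.length := by
  induction L with
  | nil => simp [memList]
  | cons y L ih =>
    simp only [memList, Timed.time_bind, time_ticks, List.length_cons]
    split_ifs
    · simp
    · omega

theorem time_unionList_le [DecidableEq Ele] (L M : List Ele) :
    (unionList L M).time ≤ L.length * (M.length + 1) := by
  induction L with
  | nil => simp [unionList]
  | cons x L ih =>
    have := time_memList_le x M
    simp only [unionList, Timed.time_bind, Timed.time_pure, time_ticks, List.length_cons,
      Nat.succ_mul]
    omega

theorem nodup_unionList [DecidableEq Ele] {L M : List Ele} (hL : L.Nodup) (hM : M.Nodup) :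
    (unionList L M).val.Nodup := by
  induction L with
  | nil => simpa [unionList] using hM
  | cons x L ih =>
    obtain ⟨hx, hL⟩ := List.nodup_cons.1 hL
    simp only [unionList, Timed.val_bind, Timed.val_pure, memList_val, decide_eq_true_eq]
    split_ifs with h
    · exact ih hL
    · refine List.nodup_cons.2 ⟨?_, ih hL⟩
      rw [mem_unionList]
      tauto

theorem time_textTest_le (c : Option String) : (textTest c : Timed (List (EQual Ele))).time ≤ 2 := by
  cases c <;> simp [textTest]

theorem length_textTest_le (c : Option String) :
    (textTest c : Timed (List (EQual Ele))).val.length ≤ 1 := by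
  cases c <;> simp [textTest]

theorem time_andVerdict_le (v w : Verdict Ele) : (andVerdict v w).time ≤ 1 := by
  cases v <;> cases w <;> simp [andVerdict]

theorem time_orVerdict_le (v w : Verdict Ele) : (orVerdict v w).time ≤ 1 := by
  cases v <;> cases w <;> simp [orVerdict]

theorem time_notVerdict_le (v : Verdict Ele) : (notVerdict v).time ≤ 1 := by
  cases v <;> simp [notVerdict]

theorem addFilter_eq_some {t t' : Trail Ele} {v : Verdict Ele} (h : addFilter t v = some t') :
    t'.reach = t.reach ∧ t'.filters.length ≤ t.filters.length + 1 := by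
  cases v with
  | ff => cases h
  | tt =>
    cases h
    exact ⟨rfl, Nat.le_succ _⟩
  | qual q =>
    cases h
    exact ⟨rfl, le_rfl⟩

/-- The number of filters that are still to be written. -/
def pending : Option (Trail Ele) → ℕ
  | none => 0
  | some t => t.filters.length

end

namespace AccessSpec

variable {Ele : Type} [Fintype Ele] {S : AccessSpec Ele}

variable (S) in
/-- A list of types of the view without repetitions. -/
def TypeList (L : List Ele) : Prop :=
  L.Nodup ∧ ∀ A ∈ L, A ∈ S.viewTypes

theorem TypeList.length_le {L : List Ele} (h : S.TypeList L) : L.length ≤ S.viewTypes.card := by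
  classical
  rw [← List.toFinset_card_of_nodup h.1]
  exact Finset.card_le_card fun A hA => h.2 A (List.mem_toFinset.1 hA)

theorem root_mem_viewTypes : S.dtd.root ∈ S.viewTypes := by
  simp [viewTypes, Relation.ReflTransGen.refl]

theorem typeList_root : S.TypeList [S.dtd.root] :=
  ⟨List.nodup_singleton _, fun _ hA => List.mem_singleton.1 hA ▸ root_mem_viewTypes⟩

theorem one_le_card_viewTypes : 1 ≤ S.viewTypes.card :=
  Finset.card_pos.2 ⟨_, root_mem_viewTypes⟩

theorem card_viewTypes_le_sq : S.viewTypes.card ≤ S.viewTypes.card ^ 2 :=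
  Nat.le_self_pow two_ne_zero _

theorem one_le_sq_card_viewTypes : 1 ≤ S.viewTypes.card ^ 2 :=
  Nat.one_le_pow _ _ one_le_card_viewTypes

theorem mem_viewTypes_of_reach {ax : DownAxis} {A B : Ele} (hA : A ∈ S.viewTypes)
    (h : S.Reach ax A B) : B ∈ S.viewTypes := by
  unfold viewTypes at hA ⊢
  simp only [Finset.mem_filter, Finset.mem_univ, true_and] at hA ⊢
  cases ax with
  | child => exact hA.tail h
  | desc => exact hA.trans (Relation.TransGen.to_reflTransGen h)

theorem length_mul_length_succ_le {L M : List Ele} (hL : L.length ≤ S.viewTypes.card)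
    (hM : M.length ≤ S.viewTypes.card) : L.length * (M.length + 1) ≤ 2 * S.viewTypes.card ^ 2 := by
  have h1 := one_le_card_viewTypes (S := S)
  calc L.length * (M.length + 1) ≤ S.viewTypes.card * (2 * S.viewTypes.card) :=
        Nat.mul_le_mul hL (by omega)
    _ = 2 * S.viewTypes.card ^ 2 := by ring

variable {L : List Ele}

theorem typeList_stepReach (ax : DownAxis) (l : NameTest Ele) (hL : S.TypeList L) :
    S.TypeList (stepReach S.tables ax L l).val := by
  cases l with
  | any =>
    simp only [stepReach, starReach_val]
    exact ⟨(Finset.nodup_toList _).filter _,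
      fun A hA => Finset.mem_toList.1 (List.mem_filter.1 hA).1⟩
  | name E =>
    simp only [stepReach, Timed.val_bind, Timed.val_pure]
    split_ifs with h
    · refine ⟨List.nodup_singleton _, fun A hA => ?_⟩
      obtain ⟨B, hB, hr⟩ := someReach_val.1 h
      rw [List.mem_singleton.1 hA]
      exact mem_viewTypes_of_reach (hL.2 B hB) (tables_reach.1 hr)
    · exact ⟨List.nodup_nil, fun A hA => by cases hA⟩

theorem time_stepReach_le (ax : DownAxis) (l : NameTest Ele) (hL : S.TypeList L) :
    (stepReach S.tables ax L l).time ≤ 2 * S.viewTypes.card ^ 2 := by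
  cases l with
  | any =>
    have hlen : S.tables.types.length ≤ S.viewTypes.card := (Finset.length_toList _).le
    exact (time_starReach_le _ _ _ _).trans (length_mul_length_succ_le hlen hL.length_le)
  | name E =>
    simp only [stepReach, Timed.time_bind, Timed.time_pure]
    have h1 := time_someReach_le S.tables ax E L
    have h2 := hL.length_le
    have h3 := card_viewTypes_le_sq (S := S)
    omega

theorem time_fusion_le_sq (ax : Axis) (hL : S.TypeList L) :
    (fusion ax L).time ≤ 6 * S.viewTypes.card ^ 2 := by
  have h1 := time_fusion_le ax L
  have h2 := hL.length_le
  have h3 := card_viewTypes_le_sq (S := S)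
  have h4 := one_le_sq_card_viewTypes (S := S)
  omega

theorem stepTrail_spec (ax : DownAxis) (l : NameTest Ele) (hL : S.TypeList L) :
    (stepTrail S.tables ax l L).time ≤ 11 * S.viewTypes.card ^ 2 ∧
      ∀ t, (stepTrail S.tables ax l L).val = some t → t.filters = [] ∧ S.TypeList t.reach := by
  have h1 := time_stepReach_le ax l hL
  have h2 := time_fusion_le_sq .self hL
  have h3 := time_fusion_le_sq .anc hL
  have h4 := one_le_sq_card_viewTypes (S := S)
  constructor
  · simp only [stepTrail, Timed.time_bind, time_ticks]
    split_ifs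
    · simp only [Timed.time_pure]
      omega
    · cases ax <;> simp only [Timed.time_bind, Timed.time_pure, time_ticks] <;> omega
  · intro t ht
    rw [stepTrail_val] at ht
    split_ifs at ht
    cases ax <;> cases ht <;> exact ⟨rfl, typeList_stepReach _ l hL⟩

theorem time_branch_le {t : Trail Ele} (ht : S.TypeList t.reach) :
    (branch t).time ≤ 6 * S.viewTypes.card ^ 2 + t.filters.length + 1 := by
  have := time_fusion_le_sq .self ht
  simp only [branch, Timed.time_bind, Timed.time_pure, time_ticks, time_applyFilters]
  omega

theorem time_closePred_le {t : Trail Ele} (ht : S.TypeList t.reach) (extra : List (EQual Ele)) :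
    (closePred S.tables t extra).time ≤
      9 * S.viewTypes.card ^ 2 + t.filters.length + extra.length := by
  have h1 := time_fusion_le_sq .desc ht
  have h2 := one_le_sq_card_viewTypes (S := S)
  simp only [closePred, Timed.time_bind, time_ticks, time_applyFilters]
  split_ifs <;> simp only [Timed.time_bind, Timed.time_pure, time_ticks] <;> omega

theorem time_closeQuery_le {o : Option (Trail Ele)} (ho : ∀ t, o = some t → S.TypeList t.reach) :
    (closeQuery S.tables o).time ≤ 9 * S.viewTypes.card ^ 2 + pending o := by
  have h2 := one_le_sq_card_viewTypes (S := S)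
  rcases o with _ | t
  · simp only [closeQuery, Timed.time_bind, Timed.time_pure, time_ticks]
    omega
  · have h1 := time_fusion_le_sq .desc (ho t rfl)
    simp only [closeQuery, Timed.time_bind, Timed.time_pure, time_ticks, time_applyFilters,
      pending]
    omega

variable [DecidableEq Ele]

theorem unionTrail_spec {o₁ o₂ : Option (Trail Ele)}
    (h₁ : ∀ t, o₁ = some t → S.TypeList t.reach) (h₂ : ∀ t, o₂ = some t → S.TypeList t.reach) :
    (unionTrail o₁ o₂).time + pending (unionTrail o₁ o₂).val ≤
        17 * S.viewTypes.card ^ 2 + pending o₁ + pending o₂ ∧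
      ∀ t, (unionTrail o₁ o₂).val = some t → S.TypeList t.reach := by
  rcases o₁ with _ | t₁
  · rw [unionTrail, Timed.val_pure, Timed.time_pure]
    exact ⟨by omega, h₂⟩
  · rcases o₂ with _ | t₂
    · rw [unionTrail, Timed.val_pure, Timed.time_pure]
      · exact ⟨by omega, h₁⟩
      · simp
    · have h₁ := h₁ t₁ rfl
      have h₂ := h₂ t₂ rfl
      have hb₁ := time_branch_le h₁
      have hb₂ := time_branch_le h₂
      have hu := (time_unionList_le t₁.reach t₂.reach).trans
        (length_mul_length_succ_le h₁.length_le h₂.length_le)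
      have hM := one_le_sq_card_viewTypes (S := S)
      simp only [unionTrail, Timed.val_bind, Timed.time_bind, Timed.val_pure, Timed.time_pure,
        time_ticks, pending, List.length_nil]
      refine ⟨by omega, fun t ht => ?_⟩
      cases ht
      refine ⟨nodup_unionList h₁.1 h₂.1, fun A hA => ?_⟩
      exact (mem_unionList.1 hA).elim (h₁.2 A) (h₂.2 A)

mutual

/-- Each of the filters counted by `pending` is written once, later on; its cost is charged in
advance. The summand `18 * |D_v|²` pays for the inner nodes of the syntax tree, which are not
counted by the size. The most expensive of them is a union inside a path, with `17 * |D_v|²` for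
merging the type lists and writing both branches and one step for the visit: it has two members
and passes on only one of their two reserves. -/
theorem trail_spec : ∀ (p : Path Ele) (L : List Ele), S.TypeList L →
    (trail S.tables p L).time + pending (trail S.tables p L).val + 18 * S.viewTypes.card ^ 2 ≤
        40 * (p.size * S.viewTypes.card ^ 2) ∧
      ∀ t, (trail S.tables p L).val = some t → S.TypeList t.reach
  | .step ax l, L, hL => by
    obtain ⟨h1, h2⟩ := stepTrail_spec ax l hL
    have hp : pending (stepTrail S.tables ax l L).val = 0 := by
      cases h : (stepTrail S.tables ax l L).val with
      | none => rfl
      | some t => simp [pending, (h2 t h).1]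
    simp only [trail, Path.size, hp, one_mul]
    exact ⟨by omega, fun t ht => (h2 t ht).2⟩
  | .filter p q, L, hL => by
    obtain ⟨hp, hpt⟩ := trail_spec p L hL
    have hM := one_le_sq_card_viewTypes (S := S)
    simp only [trail, Path.size, Timed.val_bind, Timed.time_bind, time_ticks, add_mul]
    rcases h : (trail S.tables p L).val with _ | t
    · rw [h] at hp
      refine ⟨?_, fun t ht => by cases ht⟩
      simp only [pending, Timed.val_pure, Timed.time_pure] at hp ⊢
      -- The bound for `q` from any context shows that its size is positive.
      have hq := time_rwPred_le q [S.dtd.root] typeList_root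
      omega
    · rw [h] at hp
      have ht := hpt t h
      have hq := time_rwPred_le q t.reach ht
      simp only [Timed.val_bind, Timed.time_bind, Timed.val_pure, Timed.time_pure]
      have hadd : pending (addFilter t (rwPred S.tables q t.reach).val) ≤ pending (some t) + 1 ∧
          ∀ t', addFilter t (rwPred S.tables q t.reach).val = some t' → S.TypeList t'.reach := by
        cases h' : addFilter t (rwPred S.tables q t.reach).val with
        | none => exact ⟨Nat.zero_le _, fun t' ht' => by cases ht'⟩
        | some t₁ =>
          obtain ⟨h1, h2⟩ := addFilter_eq_some h'
          refine ⟨h2, fun t' ht' => ?_⟩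
          cases ht'
          rw [h1]
          exact ht
      exact ⟨by omega, hadd.2⟩
  | .seq p q, L, hL => by
    obtain ⟨hp, hpt⟩ := trail_spec p L hL
    have hM := one_le_sq_card_viewTypes (S := S)
    simp only [trail, Path.size, Timed.val_bind, Timed.time_bind, time_ticks, add_mul]
    rcases h : (trail S.tables p L).val with _ | t₁
    · rw [h] at hp
      refine ⟨?_, fun t ht => by cases ht⟩
      simp only [pending, Timed.val_pure, Timed.time_pure] at hp ⊢
      -- The bound for `q` from any context shows that its size is positive.
      have hq := (trail_spec q [S.dtd.root] typeList_root).1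
      omega
    · rw [h] at hp
      have ht := hpt t₁ h
      obtain ⟨hq, hqt⟩ := trail_spec q t₁.reach ht
      simp only [Timed.val_bind, Timed.time_bind]
      rcases h' : (trail S.tables q t₁.reach).val with _ | t₂
      · rw [h'] at hq
        refine ⟨?_, fun t ht => by cases ht⟩
        simp only [pending, Timed.val_pure, Timed.time_pure] at hp hq ⊢
        omega
      · rw [h'] at hq
        simp only [Timed.val_bind, Timed.time_bind, Timed.val_pure, Timed.time_pure, seqTrail,
          time_applyFilters, time_ticks]
        simp only [pending] at hp hq ⊢
        refine ⟨by omega, fun t ht => ?_⟩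
        cases ht
        exact hqt t₂ h'
  | .union p q, L, hL => by
    obtain ⟨hp, hpt⟩ := trail_spec p L hL
    obtain ⟨hq, hqt⟩ := trail_spec q L hL
    obtain ⟨hu, hut⟩ := unionTrail_spec hpt hqt
    have hM := one_le_sq_card_viewTypes (S := S)
    simp only [trail, Path.size, Timed.val_bind, Timed.time_bind, time_ticks, add_mul]
    exact ⟨by omega, hut⟩

/-- A path used as a predicate keeps a reserve of 3 instead of 18, the rest having been spent by
`closePred`. -/
theorem time_rwPath_le : ∀ (p : Path Ele) (c : Option String) (L : List Ele), S.TypeList L →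
    (rwPath S.tables p c L).time + 3 * S.viewTypes.card ^ 2 ≤
      40 * (p.size * S.viewTypes.card ^ 2)
  | .step ax l, c, L, hL => by
    obtain ⟨h1, h2⟩ := stepTrail_spec ax l hL
    have hM := one_le_sq_card_viewTypes (S := S)
    have hc := time_textTest_le (Ele := Ele) c
    have hc' := length_textTest_le (Ele := Ele) c
    simp only [rwPath, Path.size, Timed.time_bind, time_ticks, one_mul]
    rcases h : (stepTrail S.tables ax l L).val with _ | t
    · simp only [Timed.time_pure]
      omega
    · obtain ⟨hf, ht⟩ := h2 t h
      have hcl := time_closePred_le ht (textTest c).val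
      simp only [hf, List.length_nil] at hcl
      simp only [Timed.time_bind]
      omega
  | .filter p q, c, L, hL => by
    obtain ⟨hp, hpt⟩ := trail_spec p L hL
    have hM := one_le_sq_card_viewTypes (S := S)
    have hc := time_textTest_le (Ele := Ele) c
    have hc' := length_textTest_le (Ele := Ele) c
    simp only [rwPath, Path.size, Timed.time_bind, time_ticks, add_mul]
    rcases h : (trail S.tables p L).val with _ | t
    · simp only [Timed.time_pure]
      omega
    · rw [h] at hp
      simp only [pending] at hp
      have ht := hpt t h
      have hq := time_rwPred_le q t.reach ht
      simp only [Timed.time_bind]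
      rcases h' : addFilter t (rwPred S.tables q t.reach).val with _ | t'
      · simp only [Timed.time_pure]
        omega
      · obtain ⟨hr, hf⟩ := addFilter_eq_some h'
        have hcl := time_closePred_le (t := t') (by rw [hr]; exact ht) (textTest c).val
        simp only [Timed.time_bind]
        omega
  | .seq p q, c, L, hL => by
    obtain ⟨hp, hpt⟩ := trail_spec p L hL
    have hM := one_le_sq_card_viewTypes (S := S)
    simp only [rwPath, Path.size, Timed.time_bind, time_ticks, add_mul]
    rcases h : (trail S.tables p L).val with _ | t
    · simp only [Timed.time_pure]
      omega
    · rw [h] at hp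
      simp only [pending] at hp
      have ht := hpt t h
      have hq := time_rwPath_le q c t.reach ht
      simp only [Timed.time_bind]
      rcases h' : addFilter t (rwPath S.tables q c t.reach).val with _ | t'
      · simp only [Timed.time_pure]
        omega
      · obtain ⟨hr, hf⟩ := addFilter_eq_some h'
        have hcl := time_closePred_le (t := t') (by rw [hr]; exact ht) []
        simp only [List.length_nil] at hcl
        dsimp only
        omega
  | .union p q, c, L, hL => by
    have hp := time_rwPath_le p c L hL
    have hq := time_rwPath_le q c L hL
    have hM := one_le_sq_card_viewTypes (S := S)
    have ho := time_orVerdict_le (rwPath S.tables p c L).val (rwPath S.tables q c L).val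
    simp only [rwPath, Path.size, Timed.time_bind, time_ticks, add_mul]
    omega

/-- The reserve is 2 here, since the qualifiers `path` and `eqText` pay one step for their visit. -/
theorem time_rwPred_le : ∀ (q : Qual Ele) (L : List Ele), S.TypeList L →
    (rwPred S.tables q L).time + 2 * S.viewTypes.card ^ 2 ≤
      40 * (q.size * S.viewTypes.card ^ 2)
  | .path p, L, hL => by
    have hp := time_rwPath_le p none L hL
    have hM := one_le_sq_card_viewTypes (S := S)
    simp only [rwPred, Qual.size, Timed.time_bind, time_ticks]
    omega
  | .eqText p c, L, hL => by
    have hp := time_rwPath_le p (some c) L hL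
    have hM := one_le_sq_card_viewTypes (S := S)
    simp only [rwPred, Qual.size, Timed.time_bind, time_ticks]
    omega
  | .and q r, L, hL => by
    have hq := time_rwPred_le q L hL
    have hr := time_rwPred_le r L hL
    have hM := one_le_sq_card_viewTypes (S := S)
    have ho := time_andVerdict_le (rwPred S.tables q L).val (rwPred S.tables r L).val
    simp only [rwPred, Qual.size, Timed.time_bind, time_ticks, add_mul]
    omega
  | .or q r, L, hL => by
    have hq := time_rwPred_le q L hL
    have hr := time_rwPred_le r L hL
    have hM := one_le_sq_card_viewTypes (S := S)
    have ho := time_orVerdict_le (rwPred S.tables q L).val (rwPred S.tables r L).val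
    simp only [rwPred, Qual.size, Timed.time_bind, time_ticks, add_mul]
    omega
  | .not q, L, hL => by
    have hq := time_rwPred_le q L hL
    have hM := one_le_sq_card_viewTypes (S := S)
    have ho := time_notVerdict_le (rwPred S.tables q L).val
    simp only [rwPred, Qual.size, Timed.time_bind, time_ticks, add_mul, one_mul]
    omega

end

theorem time_closeQuery_trail_le (p : Path Ele) :
    (trail S.tables p [S.dtd.root]).time +
        (closeQuery S.tables (trail S.tables p [S.dtd.root]).val).time +
        2 * S.viewTypes.card ^ 2 ≤ 40 * (p.size * S.viewTypes.card ^ 2) := by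
  obtain ⟨h1, h2⟩ := trail_spec p _ (typeList_root (S := S))
  have h3 := time_closeQuery_le h2
  omega

theorem time_rewriteFrom_le (p : Path Ele) :
    (rewriteFrom S.tables p S.dtd.root).time + 2 * S.viewTypes.card ^ 2 ≤
      40 * (p.size * S.viewTypes.card ^ 2) := by
  match p with
  | .step ax l => exact time_closeQuery_trail_le (.step ax l)
  | .filter p q => exact time_closeQuery_trail_le (.filter p q)
  | .seq p q => exact time_closeQuery_trail_le (.seq p q)
  | .union p q =>
    have hp := time_rewriteFrom_le p
    have hq := time_rewriteFrom_le q
    have hM := one_le_sq_card_viewTypes (S := S)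
    simp only [rewriteFrom, Path.size, Timed.time_bind, Timed.time_pure, time_ticks, add_mul]
    omega

end AccessSpec

end SecureXML

theorem mainTheorem1 :
    ∃ C : ℕ, ∀ (Ele : Type) [Fintype Ele] [DecidableEq Ele] (S : SecureXML.AccessSpec Ele),
      (∀ Q : SecureXML.Path Ele,
        (∀ (T : SecureXML.XMLTree Ele) (hT : T.Conforms S.dtd),
          Subtype.val '' Q.answer (S.view T hT) = (S.rewrite Q).val.answer T) ∧
        (S.rewrite Q).time ≤ C * Q.size * S.viewTypes.card ^ 2) ∧
      (∀ (T : SecureXML.XMLTree Ele) (hT : T.Conforms S.dtd) (n : T.Node) (A : Ele), T.label n = .elem A →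
        (S.acc.Sat T n ↔ S.Accessible T n) ∧
        ∀ (hn : S.Accessible T n) (B : Ele),
          (S.accParent B).Sat T n ↔
            ∃ m, (S.view T hT).child m ⟨n, hn⟩ ∧ (S.view T hT).label m = .elem B) := by
  refine ⟨40, fun Ele _ _ S => ⟨fun Q => ⟨fun T hT => SecureXML.AccessSpec.image_answer_view hT Q, ?_⟩,
    fun T hT n A hA => ⟨SecureXML.AccessSpec.acc_sat hT hA, fun hn _ =>
      SecureXML.AccessSpec.accParent_sat hT hn⟩⟩⟩
  rw [mul_assoc]
  exact (Nat.le_add_right _ _).trans (SecureXML.AccessSpec.time_rewriteFrom_le Q)
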